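/- **Conventions.** Let $k$ be a field and $G$ a group with unit $e$. A *multitensor category* over $k$ is a locally finite $k$-linear abelian rigid monoidal category whose monoidal product is bilinear on morphisms. A *$G$-grading* on it is a decomposition $\mathcal C=\bigoplus_{g\in G}\mathcal C_g$ into abelian full (isomorphism-closed) subcategories with $\mathcal C_g\otimes\mathcal C_h\subset\mathcal C_{gh}$. A *$G$-crossed multitensor category* is a pivotal $G$-graded multitensor category (with pivotal structure $\delta_\lambda:\lambda\cong\lambda^{\vee\vee}$) with an action $g\mapsto{}^g(-)$ of $G$ by pivotal tensor autoequivalences such that ${}^g\mathcal C_h\subset\mathcal C_{ghg^{-1}}$. A *$G$-braided multitensor category* is a $G$-crossed multitensor category with natural isomorphisms $b_{\lambda,\mu}:\lambda\otimes\mu\cong{}^g\mu\otimes\lambda$ for $\lambda\in\mathcal C_g$, $\mu\in\mathcal C$ such that, up to the canonical coherence isomorphisms, ${}^hb_{\lambda,\mu}=b_{{}^h\lambda,{}^h\mu}$, $b_{\lambda_1\lambda_2,\mu}=(b_{\lambda_1,{}^{g_2}\mu}\otimes\mathrm{id})(\mathrm{id}\otimes b_{\lambda_2,\mu})$ for $\lambda_i\in\mathcal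 C_{g_i}$, and $b_{\lambda,\mu_1\mu_2}=(\mathrm{id}\otimes b_{\lambda,\mu_2})(b_{\lambda,\mu_1}\otimes\mathrm{id})$. **Theorem.** Let $\mathcal C$ be a $G$-braided multitensor category over $k$. On the $k$-linear abelian category $\mathcal C$ with its given action of $G$ (by linear autoequivalences), and with the components $\mathcal C^{\mathrm{rev}}_g:=\mathcal C_{g^{-1}}$, there is a structure of a $G$-braided multitensor category $\mathcal C^{\mathrm{rev}}$ such that: 1. its unit object is $\mathbf 1^{\mathcal C}$, and there are isomorphisms $\lambda\otimes^{\mathrm{rev}}\mu\cong{}^{h}\lambda\otimes\mu$ for $\lambda\in\mathcal C$, $\mu\in\mathcal C_h$, $h\in G$, natural in $\lambda$ and in $\mu\in\mathcal C_h$ (so $\otimes^{\mathrm{rev}}$ is the additive extension of $(\lambda,\mu)\mapsto{}^{\partial\mu}\lambda\otimes\mu$); 2. under these isomorphisms, the associator ($(\lambda\otimes^{\mathrm{rev}}\mu)\otimes^{\mathrm{rev}}\nu={}^h({}^g\lambda\otimes\mu)\otimes\nu\cong{}^{hg}\lambda\otimes({}^h\mu\otimes\nu)=\lambda\otimes^{\mathrm{rev}}(\mu\otimes^{\mathrm{rev}}\nu)$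 for $\mu\in\mathcal C_g,\nu\in\mathcal C_h$), the unitors (${}^h\mathbf 1\otimes\lambda\cong\lambda$ for $\lambda\in\mathcal C_h$, and ${}^e\lambda\otimes\mathbf 1\cong\lambda$) and the monoidal structure of the action of $G$ are the canonical coherence isomorphisms of $\mathcal C$; 3. for $\lambda\in\mathcal C^{\mathrm{rev}}_g=\mathcal C_{g^{-1}}$ and $\mu\in\mathcal C_h$, under these isomorphisms the $G$-braiding $b^{\mathrm{rev}}_{\lambda,\mu}:\lambda\otimes^{\mathrm{rev}}\mu\cong{}^g\mu\otimes^{\mathrm{rev}}\lambda$ is $b^{-}_{\lambda,\mu}:=(b_{\mu,\lambda})^{-1}:{}^h\lambda\otimes\mu\cong\mu\otimes\lambda$ (using ${}^{g^{-1}}({}^g\mu)\cong\mu$); 4. the pivotal structure is inherited: for $\lambda\in\mathcal C_h$, the object ${}^{h^{-1}}(\lambda^\vee)$ with $\mathrm{ev}_\lambda$ and ${}^{h^{-1}}\mathrm{coev}_\lambda$ is a dual of $\lambda$ in $\mathcal C^{\mathrm{rev}}$, the object $\lambda^{\vee\vee}$ with ${}^{h^{-1}}\mathrm{ev}_{\lambda^\vee}$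 and $\mathrm{coev}_{\lambda^\vee}$ is a dual of ${}^{h^{-1}}(\lambda^\vee)$ in $\mathcal C^{\mathrm{rev}}$, and under the resulting identification of double duals $\delta^{\mathrm{rev}}_\lambda=\delta_\lambda$. -/

import Mathlib

open CategoryTheory CategoryTheory.Limits CategoryTheory.MonoidalCategory

universe w v u t

noncomputable section

namespace GBraidedReverse

/-! ### Multitensor categories -/

/-- An object of finite length: it has a finite filtration with simple quotients. -/
inductive FiniteLength {C : Type u} [Category.{v} C] [Abelian C] : C → Prop
  | zero {X : C} (hX : IsZero X) : FiniteLength X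
  | extension {X Y Z : C} (f : X ⟶ Y) (g : Y ⟶ Z) (w : f ≫ g = 0)
      (hS : (ShortComplex.mk f g w).ShortExact) (hX : FiniteLength X) (hZ : Simple Z) :
      FiniteLength Y

/-- A locally finite `k`-linear abelian category: morphism spaces are finite dimensional and
objects have finite length. -/
class LocallyFinite (k : Type w) (C : Type u) [Field k] [Category.{v} C] [Abelian C]
    [Linear k C] : Prop where
  finiteDimensional_hom : ∀ X Y : C, FiniteDimensional k (X ⟶ Y)
  finiteLength : ∀ X : C, FiniteLength X

/-- The structure of a multitensor category over `k` on a `k`-linear abelian category: locally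
finite, monoidal with a product that is `k`-bilinear on morphisms, and rigid. -/
class MultitensorCategory (k : Type w) (C : Type u) [Field k] [Category.{v} C] [Abelian C]
    [Linear k C] extends LocallyFinite k C, MonoidalCategory C, MonoidalPreadditive C,
    MonoidalLinear k C, RigidCategory C

/-! ### Pivotal structures

The dual `λ^∨`, with `ev : λ^∨ ⊗ λ ⟶ 1` and `coev : 1 ⟶ λ ⊗ λ^∨`, is Mathlib's `λᘁ`. -/

section Pivotal

variable {C : Type u} [Category.{v} C] [MonoidalCategory C]

/-- If `X'` is a dual of `X` and `X''` is a dual of `X'`, then `X''` is canonically isomorphic to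
the chosen double dual of `X`. -/
def doubleDualIso [RightRigidCategory C] {X X' X'' : C} (p : ExactPairing X X')
    (q : ExactPairing X' X'') : X'' ≅ (Xᘁ)ᘁ :=
  rightDualIso q (exactPairingCongrLeft (rightDualIso p (inferInstance : ExactPairing X Xᘁ)))

/-- A pivotal structure: a monoidal natural isomorphism from the identity to the double dual. -/
structure PivotalStructure (C : Type u) [Category.{v} C] [MonoidalCategory C]
    [RightRigidCategory C] where
  iso : ∀ X : C, X ≅ (Xᘁ)ᘁ
  naturality : ∀ {X Y : C} (f : X ⟶ Y),
    f ≫ (iso Y).hom = (iso X).hom ≫ rightAdjointMate (rightAdjointMate f)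
  tensor : ∀ X Y : C, (iso (X ⊗ Y)).hom = ((iso X).hom ⊗ₘ (iso Y).hom) ≫
    (doubleDualIso (inferInstance : ExactPairing (X ⊗ Y) (Yᘁ ⊗ Xᘁ))
      (inferInstance : ExactPairing (Yᘁ ⊗ Xᘁ) ((Xᘁ)ᘁ ⊗ (Yᘁ)ᘁ))).hom

variable {D : Type u} [Category.{v} D] [MonoidalCategory D]

open Functor.LaxMonoidal Functor.OplaxMonoidal in
/-- The image of a dual pair under a monoidal functor is a dual pair. -/
@[reducible]
def mapExactPairing (F : C ⥤ D) [F.Monoidal] {X Y : C} (p : ExactPairing X Y) :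
    ExactPairing (F.obj X) (F.obj Y) where
  coevaluation' := ε F ≫ F.map (p.coevaluation X Y) ≫ δ F X Y
  evaluation' := μ F Y X ≫ F.map (p.evaluation X Y) ≫ η F
  coevaluation_evaluation' := by
    have h := congrArg (fun t => F.obj Y ◁ ε F ≫ μ F Y (𝟙_ C) ≫ F.map t ≫ δ F (𝟙_ C) Y ≫
      η F ▷ F.obj Y) (p.coevaluation_evaluation X Y)
    simp only [Functor.map_comp, Functor.Monoidal.map_whiskerLeft,
      Functor.Monoidal.map_whiskerRight, Functor.Monoidal.map_associator_inv,
      Category.assoc,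
      Functor.Monoidal.μ_δ_assoc] at h
    simp
    simpa only [Category.assoc] using h
  evaluation_coevaluation' := by
    have h := congrArg (fun t => ε F ▷ F.obj X ≫ μ F (𝟙_ C) X ≫ F.map t ≫ δ F X (𝟙_ C) ≫
      F.obj X ◁ η F) (p.evaluation_coevaluation X Y)
    simp only [Functor.map_comp, Functor.Monoidal.map_whiskerLeft,
      Functor.Monoidal.map_whiskerRight, Functor.Monoidal.map_associator,
      Category.assoc,
      Functor.Monoidal.μ_δ_assoc] at h
    simp
    simpa only [Category.assoc] using h

/-- A monoidal functor `F` is pivotal if `δ F = F δ`, under the canonical identification of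
`F (X^∨∨)` with `F(X)^∨∨`. -/
def IsPivotalFunctor [RightRigidCategory C] [RightRigidCategory D] (F : C ⥤ D) [F.Monoidal]
    (δC : PivotalStructure C) (δD : PivotalStructure D) : Prop :=
  ∀ X : C, (δD.iso (F.obj X)).hom = F.map (δC.iso X).hom ≫
    (doubleDualIso (mapExactPairing F (inferInstance : ExactPairing X Xᘁ))
      (mapExactPairing F (inferInstance : ExactPairing Xᘁ (Xᘁ)ᘁ))).hom

end Pivotal

/-! ### Group actions -/

section Action

variable (k : Type w) (G : Type t) (C : Type u) [Field k] [Group G] [Category.{v} C] [Abelian C]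
  [Linear k C]

/-- A (weak) action of `G` on a `k`-linear abelian category by `k`-linear autoequivalences:
a monoidal functor from the discrete monoidal category of `G` to the autoequivalences of `C`. -/
structure GAction where
  act : G → C ⥤ C
  isEquivalence : ∀ g, (act g).IsEquivalence
  additive : ∀ g, (act g).Additive
  linear : ∀ g, (act g).Linear k
  mul : ∀ g h : G, act h ⋙ act g ≅ act (g * h)
  one : 𝟭 C ≅ act 1
  assoc : ∀ (g h l : G) (X : C),
    (act g).map ((mul h l).hom.app X) ≫ (mul g (h * l)).hom.app X =
      (mul g h).hom.app ((act l).obj X) ≫ (mul (g * h) l).hom.app X ≫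
        eqToHom (by rw [mul_assoc])
  one_left : ∀ (g : G) (X : C),
    one.hom.app ((act g).obj X) ≫ (mul 1 g).hom.app X = eqToHom (by rw [one_mul]; rfl)
  one_right : ∀ (g : G) (X : C),
    (act g).map (one.hom.app X) ≫ (mul g 1).hom.app X = eqToHom (by rw [mul_one]; rfl)

variable {k G C}

/-- The canonical isomorphism from `^g(^h X)` to `^l X` when `l = g h`. -/
def GAction.mulIso (A : GAction k G C) {g h l : G} (e : g * h = l) (X : C) :
    (A.act g).obj ((A.act h).obj X) ≅ (A.act l).obj X :=
  (A.mul g h).app X ≪≫ eqToIso (by rw [e])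

/-- The canonical isomorphism from `^e X` to `X`. -/
def GAction.oneIso (A : GAction k G C) (X : C) : (A.act 1).obj X ≅ X :=
  (A.one.app X).symm

/-- The canonical isomorphism from `^g(^h X)` to `X` when `g h = e`. -/
def GAction.cancelIso (A : GAction k G C) {g h : G} (e : g * h = 1) (X : C) :
    (A.act g).obj ((A.act h).obj X) ≅ X :=
  A.mulIso e X ≪≫ A.oneIso X

end Action

/-! ### `G`-graded, `G`-crossed and `G`-braided multitensor categories -/

section Crossed

variable {k : Type w} {G : Type t} {C : Type u} [Field k] [Group G] [Category.{v} C] [Abelian C]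
  [Linear k C]

attribute [local instance] Abelian.hasFiniteBiproducts

/-- A `G`-grading: abelian full (replete) subcategories `C_g`, given by their objects, such that
`C` is their direct sum, compatible with the monoidal product. -/
structure IsGGrading [MonoidalCategory C] (P : G → ObjectProperty C) : Prop where
  iso : ∀ g, (P g).IsClosedUnderIsomorphisms
  zero : ∀ g, (P g).ContainsZero
  kernels : ∀ g, (P g).IsClosedUnderKernels
  cokernels : ∀ g, (P g).IsClosedUnderCokernels
  finiteProducts : ∀ g, (P g).IsClosedUnderFiniteProducts
  hom_eq_zero : ∀ {g h : G} {X Y : C}, g ≠ h → P g X → P h Y → ∀ f : X ⟶ Y, f = 0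
  decomposition : ∀ Y : C, ∃ (S : Finset G) (X : S → C),
    (∀ g : S, P g (X g)) ∧ Nonempty (Y ≅ ⨁ X)
  tensor : ∀ {g h : G} {X Y : C}, P g X → P h Y → P (g * h) (X ⊗ Y)

/-- The structure of a `G`-crossed multitensor category on a multitensor category `C`, whose
underlying `G`-action on the linear abelian category `C` is `A` and whose homogeneous components
are `P`: a `G`-grading, a pivotal structure, and monoidal structures on the functors of the action
making it an action by pivotal tensor autoequivalences, with `^g(C_h) ⊆ C_{g h g⁻¹}`. -/
structure GCrossed [MultitensorCategory k C] (A : GAction k G C) (P : G → ObjectProperty C) where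
  grading : IsGGrading P
  pivotal : PivotalStructure C
  monoidal : ∀ g, (A.act g).Monoidal
  mul_isMonoidal : ∀ g h, NatTrans.IsMonoidal (A.mul g h).hom
  one_isMonoidal : NatTrans.IsMonoidal A.one.hom
  isPivotal : ∀ g, IsPivotalFunctor (A.act g) pivotal pivotal
  act_mem : ∀ (g : G) {h : G} {X : C}, P h X → P (g * h * g⁻¹) ((A.act g).obj X)

open Functor.LaxMonoidal Functor.OplaxMonoidal in
/-- The structure of a `G`-braided multitensor category: a `G`-crossed structure and isomorphisms
`b_{X,Y} : X ⊗ Y ≅ ^g Y ⊗ X` for `X ∈ C_g` and `Y ∈ C`. -/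
structure GBraided [MultitensorCategory k C] (A : GAction k G C) (P : G → ObjectProperty C)
    extends GCrossed A P where
  braiding : ∀ {g : G} {X : C}, P g X → ∀ Y : C, X ⊗ Y ≅ (A.act g).obj Y ⊗ X
  braiding_naturality : ∀ {g : G} {X X' Y Y' : C} (hX : P g X) (hX' : P g X') (f : X ⟶ X')
    (f' : Y ⟶ Y'),
    (f ⊗ₘ f') ≫ (braiding hX' Y').hom = (braiding hX Y).hom ≫ ((A.act g).map f' ⊗ₘ f)
  braiding_act : ∀ (h : G) {g : G} {X : C} (hX : P g X) (Y : C),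
    μ (A.act h) X Y ≫ (A.act h).map (braiding hX Y).hom ≫ δ (A.act h) ((A.act g).obj Y) X ≫
        (A.mulIso rfl Y).hom ▷ (A.act h).obj X =
      (braiding (act_mem h hX) ((A.act h).obj Y)).hom ≫
        (A.mulIso (by group) Y).hom ▷ (A.act h).obj X
  braiding_tensor_left : ∀ {g₁ g₂ : G} {X₁ X₂ : C} (h₁ : P g₁ X₁) (h₂ : P g₂ X₂) (Y : C),
    (braiding (grading.tensor h₁ h₂) Y).hom =
      (α_ X₁ X₂ Y).hom ≫ X₁ ◁ (braiding h₂ Y).hom ≫ (α_ X₁ ((A.act g₂).obj Y) X₂).inv ≫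
        (braiding h₁ ((A.act g₂).obj Y)).hom ▷ X₂ ≫ (A.mulIso rfl Y).hom ▷ X₁ ▷ X₂ ≫
          (α_ ((A.act (g₁ * g₂)).obj Y) X₁ X₂).hom
  braiding_tensor_right : ∀ {g : G} {X : C} (hX : P g X) (Y₁ Y₂ : C),
    (braiding hX (Y₁ ⊗ Y₂)).hom =
      (α_ X Y₁ Y₂).inv ≫ (braiding hX Y₁).hom ▷ Y₂ ≫ (α_ ((A.act g).obj Y₁) X Y₂).hom ≫
        (A.act g).obj Y₁ ◁ (braiding hX Y₂).hom ≫
          (α_ ((A.act g).obj Y₁) ((A.act g).obj Y₂) X).inv ≫ μ (A.act g) Y₁ Y₂ ▷ X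

/-- If `Y ∈ C_g` and `Z ∈ C_h`, then objects isomorphic to `^h Y ⊗ Z` lie in `C_{h g}`. -/
theorem GBraided.mem_of_iso [MultitensorCategory k C] {A : GAction k G C}
    {P : G → ObjectProperty C} (B : GBraided A P) {g h : G} {Y Z W : C}
    (e : W ≅ (A.act h).obj Y ⊗ Z) (hY : P g Y) (hZ : P h Z) : P (h * g) W := by
  have h₁ := B.grading.tensor (B.act_mem h hY) hZ
  rw [inv_mul_cancel_right] at h₁
  have := B.grading.iso (h * g)
  exact (P (h * g)).prop_of_iso e.symm h₁

/-- A structure of a `G`-braided multitensor category on a linear abelian category with a given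
action of `G` and given homogeneous components. It is kept bundled (and is not a class), so that
a second monoidal structure on a category can be discussed. -/
structure GBraidedMultitensor (A : GAction k G C) (P : G → ObjectProperty C) where
  mt : MultitensorCategory k C
  braided : GBraided A P

end Crossed

namespace GBraidedMultitensor

variable {k : Type w} {G : Type t} {C : Type u} [Field k] [Group G] [Category.{v} C] [Abelian C]
  [Linear k C] {A : GAction k G C} {P : G → ObjectProperty C} (R : GBraidedMultitensor A P)

/-- The monoidal product. -/
def tensorObj (X Y : C) : C := R.mt.tensorObj X Y

/-- The monoidal product of morphisms. -/
def tensorHom {X X' Y Y' : C} (f : X ⟶ X') (f' : Y ⟶ Y') :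
    R.tensorObj X Y ⟶ R.tensorObj X' Y' :=
  R.mt.tensorHom f f'

/-- The monoidal unit. -/
def unit : C := R.mt.tensorUnit

/-- The associator. -/
def associator (X Y Z : C) :
    R.tensorObj (R.tensorObj X Y) Z ≅ R.tensorObj X (R.tensorObj Y Z) :=
  R.mt.associator X Y Z

/-- The left unitor. -/
def leftUnitor (X : C) : R.tensorObj R.unit X ≅ X := R.mt.leftUnitor X

/-- The right unitor. -/
def rightUnitor (X : C) : R.tensorObj X R.unit ≅ X := R.mt.rightUnitor X

/-- The monoidal structure `^g X ⊗ ^g Y ⟶ ^g (X ⊗ Y)` of the action. -/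
def actTensor (g : G) (X Y : C) :
    R.tensorObj ((A.act g).obj X) ((A.act g).obj Y) ⟶ (A.act g).obj (R.tensorObj X Y) :=
  letI := R.mt
  letI := R.braided.monoidal g
  Functor.LaxMonoidal.μ (A.act g) X Y

/-- The unit isomorphism `1 ⟶ ^g 1` of the action. -/
def actUnit (g : G) : R.unit ⟶ (A.act g).obj R.unit :=
  letI := R.mt
  letI := R.braided.monoidal g
  Functor.LaxMonoidal.ε (A.act g)

/-- The `G`-braiding. -/
def braiding {g : G} {X : C} (hX : P g X) (Y : C) :
    R.tensorObj X Y ≅ R.tensorObj ((A.act g).obj Y) X :=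
  letI := R.mt
  R.braided.braiding hX Y

/-- Exact pairings for the monoidal structure; `Y` is a dual of `X`. -/
def Pairing (X Y : C) : Type v :=
  letI := R.mt
  ExactPairing X Y

/-- The evaluation of an exact pairing. -/
def ev {X Y : C} (p : R.Pairing X Y) : R.tensorObj Y X ⟶ R.unit :=
  letI := R.mt
  @ExactPairing.evaluation C _ _ X Y p

/-- The coevaluation of an exact pairing. -/
def coev {X Y : C} (p : R.Pairing X Y) : R.unit ⟶ R.tensorObj X Y :=
  letI := R.mt
  @ExactPairing.coevaluation C _ _ X Y p

/-- The double dual for the monoidal structure. -/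
def doubleDual (X : C) : C :=
  letI := R.mt
  (Xᘁ)ᘁ

/-- The canonical isomorphism from a dual of a dual of `X` to the double dual of `X`. -/
def toDoubleDual {X X' X'' : C} (p : R.Pairing X X') (q : R.Pairing X' X'') :
    X'' ≅ R.doubleDual X :=
  letI := R.mt
  doubleDualIso p q

/-- The pivotal structure. -/
def pivotalIso (X : C) : X ≅ R.doubleDual X :=
  letI := R.mt
  R.braided.pivotal.iso X

end GBraidedMultitensor

/-! ### The reverse -/

section Reverse

variable {k : Type w} {G : Type t} {C : Type u} [Field k] [Group G] [Category.{v} C] [Abelian C]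
  [Linear k C] [MultitensorCategory k C] {A : GAction k G C} {P : G → ObjectProperty C}

/-- The structure morphisms of `B`: `^g X ⊗ ^g Y ≅ ^g (X ⊗ Y)`. -/
def GBraided.actTensorIso (B : GBraided A P) (g : G) (X Y : C) :
    (A.act g).obj X ⊗ (A.act g).obj Y ≅ (A.act g).obj (X ⊗ Y) :=
  letI := B.monoidal g
  Functor.Monoidal.μIso (A.act g) X Y

/-- The structure morphisms of `B`: `1 ≅ ^g 1`. -/
def GBraided.actUnitIso (B : GBraided A P) (g : G) : 𝟙_ C ≅ (A.act g).obj (𝟙_ C) :=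
  letI := B.monoidal g
  Functor.Monoidal.εIso (A.act g)

/-- `ReverseData B R` exhibits `R`, a `G`-braided multitensor structure on the abelian category `C`
with the same action of `G` and with components `C_{g⁻¹}`, as the reverse of `B`: its product is
(the extension to all `Y` of) `(X, Y) ↦ ^h X ⊗ Y` for `Y ∈ C_h`, its unit is that of `B`, its
constraints are those induced by the constraints of `B`, and its braiding is the inverse of that
of `B`. -/
structure ReverseData (B : GBraided A P) (R : GBraidedMultitensor A (fun g => P g⁻¹)) where
  /-- The unit object is that of `B`. -/
  unit_eq : R.unit = 𝟙_ C
  unit_mem : P 1 R.unit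
  /-- The product of `X` and `Y ∈ C_h` is `^h X ⊗ Y`. -/
  tensorIso : ∀ (X : C) {h : G} {Y : C}, P h Y → (R.tensorObj X Y ≅ (A.act h).obj X ⊗ Y)
  tensorIso_naturality : ∀ {h : G} {X X' Y Y' : C} (hY : P h Y) (hY' : P h Y') (f : X ⟶ X')
    (f' : Y ⟶ Y'),
    R.tensorHom f f' ≫ (tensorIso X' hY').hom =
      (tensorIso X hY).hom ≫ ((A.act h).map f ⊗ₘ f')
  /-- The associator is the canonical isomorphism from `^h(^g X ⊗ Y) ⊗ Z` to
  `^{hg} X ⊗ (^h Y ⊗ Z)`. -/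
  associator_eq : ∀ (X : C) {g h : G} {Y Z : C} (hY : P g Y) (hZ : P h Z),
    (R.associator X Y Z).hom ≫
        (tensorIso X (B.mem_of_iso (tensorIso Y hZ) hY hZ)).hom ≫
          (A.act (h * g)).obj X ◁ (tensorIso Y hZ).hom =
      (tensorIso (R.tensorObj X Y) hZ).hom ≫ (A.act h).map (tensorIso X hY).hom ▷ Z ≫
        (B.actTensorIso h ((A.act g).obj X) Y).inv ▷ Z ≫
          (α_ ((A.act h).obj ((A.act g).obj X)) ((A.act h).obj Y) Z).hom ≫
            (A.mulIso rfl X).hom ▷ ((A.act h).obj Y ⊗ Z)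
  /-- The left unitor is the canonical isomorphism from `^h 1 ⊗ X` to `X`. -/
  leftUnitor_eq : ∀ {h : G} {X : C} (hX : P h X),
    (R.leftUnitor X).hom =
      (tensorIso R.unit hX).hom ≫ (A.act h).map (eqToHom unit_eq) ▷ X ≫
        (B.actUnitIso h).inv ▷ X ≫ (λ_ X).hom
  /-- The right unitor is the canonical isomorphism from `^e X ⊗ 1` to `X`. -/
  rightUnitor_eq : ∀ X : C,
    (R.rightUnitor X).hom =
      (tensorIso X unit_mem).hom ≫ ((A.oneIso X).hom ⊗ₘ eqToHom unit_eq) ≫ (ρ_ X).hom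
  /-- The action is monoidal through the canonical isomorphism from `^{ghg⁻¹}(^g X) ⊗ ^g Y` to
  `^g(^h X ⊗ Y)`. -/
  actTensor_eq : ∀ (g : G) (X : C) {h : G} {Y : C} (hY : P h Y),
    R.actTensor g X Y ≫ (A.act g).map (tensorIso X hY).hom ≫
        (B.actTensorIso g ((A.act h).obj X) Y).inv ≫
          (A.mulIso rfl X).hom ▷ (A.act g).obj Y =
      (tensorIso ((A.act g).obj X) (B.act_mem g hY)).hom ≫
        (A.mulIso (by group) X).hom ▷ (A.act g).obj Y
  actUnit_eq : ∀ g : G,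
    R.actUnit g ≫ (A.act g).map (eqToHom unit_eq) = eqToHom unit_eq ≫ (B.actUnitIso g).hom
  /-- For `X ∈ C^rev_g = C_{g⁻¹}` and `Y ∈ C_h`, the braiding from `X ⊗^rev Y = ^h X ⊗ Y` to
  `^g Y ⊗^rev X = ^{g⁻¹}(^g Y) ⊗ X = Y ⊗ X` is the inverse of `b_{Y,X} : Y ⊗ X ≅ ^h X ⊗ Y`. -/
  braiding_eq : ∀ {g h : G} {X Y : C} (hX : P g⁻¹ X) (hY : P h Y),
    (R.braiding (g := g) hX Y).hom ≫ (tensorIso ((A.act g).obj Y) hX).hom ≫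
        (A.cancelIso (inv_mul_cancel g) Y).hom ▷ X =
      (tensorIso X hY).hom ≫ (B.braiding hY X).inv
  /-- For `X ∈ C_h`, the dual for the reverse product is `^{h⁻¹}(X^∨)`, with evaluation `ev_X` and
  coevaluation `^{h⁻¹} coev_X`; its dual is in turn `X^∨∨`, with evaluation `^{h⁻¹} ev_{X^∨}` and
  coevaluation `coev_{X^∨}`. Under these identifications of the double duals, the pivotal structure
  of the reverse is that of `B`. -/
  pivotal_eq : ∀ {h : G} {X : C} (hX : P h X),
    ∃ (hD : P h⁻¹ ((A.act h⁻¹).obj Xᘁ)) (hDD : P h ((Xᘁ)ᘁ))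
      (p : R.Pairing X ((A.act h⁻¹).obj Xᘁ)) (q : R.Pairing ((A.act h⁻¹).obj Xᘁ) ((Xᘁ)ᘁ)),
      R.ev p = (tensorIso ((A.act h⁻¹).obj Xᘁ) hX).hom ≫
        (A.cancelIso (mul_inv_cancel h) Xᘁ).hom ▷ X ≫
          ExactPairing.evaluation X Xᘁ ≫ eqToHom unit_eq.symm ∧
      R.coev p ≫ (tensorIso X hD).hom = eqToHom unit_eq ≫ (B.actUnitIso h⁻¹).hom ≫
        (A.act h⁻¹).map (ExactPairing.coevaluation X Xᘁ) ≫ (B.actTensorIso h⁻¹ X Xᘁ).inv ∧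
      R.ev q = (tensorIso ((Xᘁ)ᘁ) hD).hom ≫ (B.actTensorIso h⁻¹ ((Xᘁ)ᘁ) Xᘁ).hom ≫
        (A.act h⁻¹).map (ExactPairing.evaluation Xᘁ ((Xᘁ)ᘁ)) ≫ (B.actUnitIso h⁻¹).inv ≫
          eqToHom unit_eq.symm ∧
      R.coev q ≫ (tensorIso ((A.act h⁻¹).obj Xᘁ) hDD).hom ≫
          (A.cancelIso (mul_inv_cancel h) Xᘁ).hom ▷ (Xᘁ)ᘁ =
        eqToHom unit_eq ≫ ExactPairing.coevaluation Xᘁ ((Xᘁ)ᘁ) ∧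
      (R.pivotalIso X).hom = (B.pivotal.iso X).hom ≫ (R.toDoubleDual p q).hom

end Reverse

end GBraidedReverse

end

/-!
The reverse of a `G`-braided multitensor category `C` can be taken to be `C` with the opposite
product `(X, Y) ↦ Y ⊗ X`: for `Y ∈ C_h` the `G`-braiding `b_{Y,X} : Y ⊗ X ≅ ^h X ⊗ Y` identifies it
with `(X, Y) ↦ ^h X ⊗ Y`. With this choice no extension of the product from homogeneous objects is
needed. The associator, the unitors and the monoidal structure of the action are those of `C`, read
backwards, and the statement that they correspond to the canonical isomorphisms of `C` is the
compatibility of `b` with products on the left and on the right, with the unit, and with the action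
(`GBraided.braiding_tensor_left`, `GBraided.braiding_tensor_right`, `GBraided.braiding_unit_right`,
`GBraided.braiding_unit_left`, `GBraided.braiding_act`). The reverse `G`-braiding of `X ∈ C_{g⁻¹}`
with `Y` is the inverse of the isomorphism `X ⊗ ^g Y ≅ Y ⊗ X` coming from `b`
(`GBraided.unbraiding`), so that its axioms are those of `b`, inverted.

The real work is in the pivotal structure. If `X ∈ C_h` has dual `X'`, then `^{h⁻¹} X'` is a dual of
`X` for the opposite product (`GBraided.reverseDual`), and if `X'` has dual `X''`, then `X''` is a
dual of `^{h⁻¹} X'` (`GBraided.reverseDualDual`). This gives an isomorphism from `X` to its reverse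
double dual for homogeneous `X`, which is natural and so extends to all of `C`
(`IsGGrading.exists_natural_extension`). To see that it is monoidal and preserved by the action, a
morphism `δ` from `X` to its double dual is encoded by the pairing `X ⊗ X' ⟶ 1` to which it
corresponds (`pivotalEv`). In these terms monoidality says that the pairing of a product is obtained
by nesting the pairings of the factors (`pivotalEv_tensor_iff`), and a functor is pivotal if it
preserves the pairings (`pivotalEv_map_iff`). Passing to the reverse sends a pairing
`φ : X ⊗ X' ⟶ 1` to the composite of the braiding `^{h⁻¹} X' ⊗ X ≅ ^{h⁻¹} X ⊗ ^{h⁻¹} X'` and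
`^{h⁻¹} φ` (`GBraided.reverseEv`). The two duals of a product for the opposite product, namely the
product of the duals and the dual of the product, differ by a full twist
(`GBraided.reverseDualTensor`), and `GBraided.reverseDualTensor_ev` and
`GBraided.reverseDualTensor_reverseEv` say that this twist respects evaluations and the pairings of
the reverse pivotal structure.
-/

noncomputable section

namespace GBraidedReverse

/-! ### Dual pairs and double duals -/

section Pairings

variable {C : Type u} [Category.{v} C] [MonoidalCategory C]

/-- The evaluation of an exact pairing is nondegenerate. -/
theorem ev_ext {X X' A : C} (p : ExactPairing X X') {f g : A ⟶ X'}
    (h : f ▷ X ≫ p.evaluation X X' = g ▷ X ≫ p.evaluation X X') : f = g := by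
  let _ : HasRightDual X := ⟨X'⟩
  have h' := congrArg (tensorRightHomEquiv A X X' (𝟙_ C)) h
  have e (k : A ⟶ Xᘁ) := tensorRightHomEquiv_whiskerRight_comp_evaluation k
  exact (cancel_mono (λ_ X').inv).1 (((e f).symm.trans h').trans (e g))

theorem rightDualIso_ev {X Y₁ Y₂ : C} (p : ExactPairing X Y₁) (q : ExactPairing X Y₂) :
    (rightDualIso p q).hom ▷ X ≫ q.evaluation X Y₂ = p.evaluation X Y₁ := by
  have := @rightAdjointMate_comp_evaluation C _ _ X X ⟨Y₂⟩ ⟨Y₁⟩ (𝟙 X)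
  simpa [rightDualIso] using this

/-- Two pairings, one nested inside the other. -/
def nestedPairing {X X' Y Y' : C} (eX : X ⊗ X' ⟶ 𝟙_ C) (eY : Y ⊗ Y' ⟶ 𝟙_ C) :
    (X ⊗ Y) ⊗ (Y' ⊗ X') ⟶ 𝟙_ C :=
  (α_ X Y (Y' ⊗ X')).hom ≫ X ◁ ((α_ Y Y' X').inv ≫ eY ▷ X' ≫ (λ_ X').hom) ≫ eX

theorem tensor_evaluation_eq {X X' Y Y' : C} [ExactPairing X X'] [ExactPairing Y Y'] :
    ExactPairing.evaluation (X ⊗ Y) (Y' ⊗ X') =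
      nestedPairing (ExactPairing.evaluation Y Y') (ExactPairing.evaluation X X') := by
  rw [ExactPairing.tensor_evaluation, nestedPairing]
  monoidal

theorem tensor_nestedPairing_left {X X₂ X' Y Y₂ Y' : C} (a : X ⟶ X₂) (b : Y ⟶ Y₂)
    (eX : X₂ ⊗ X' ⟶ 𝟙_ C) (eY : Y₂ ⊗ Y' ⟶ 𝟙_ C) :
    (a ⊗ₘ b) ▷ (Y' ⊗ X') ≫ nestedPairing eX eY =
      nestedPairing (a ▷ X' ≫ eX) (b ▷ Y' ≫ eY) := by
  simp only [nestedPairing]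
  rw [MonoidalCategory.tensorHom_def']
  simp only [comp_whiskerRight, Category.assoc, associator_naturality_left_assoc,
    associator_naturality_middle_assoc, ← whisker_exchange_assoc, whiskerLeft_comp]
  simp

theorem tensor_nestedPairing_right {X X' X₂' Y Y' Y₂' : C} (c : Y' ⟶ Y₂') (d : X' ⟶ X₂')
    (eX : X ⊗ X₂' ⟶ 𝟙_ C) (eY : Y ⊗ Y₂' ⟶ 𝟙_ C) :
    (X ⊗ Y) ◁ (c ⊗ₘ d) ≫ nestedPairing eX eY =
      nestedPairing (X ◁ d ≫ eX) (Y ◁ c ≫ eY) := by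
  have h : Y ◁ (c ⊗ₘ d) ≫ (α_ Y Y₂' X₂').inv ≫ eY ▷ X₂' ≫ (λ_ X₂').hom =
      (α_ Y Y' X').inv ≫ (Y ◁ c ≫ eY) ▷ X' ≫ (λ_ X').hom ≫ d := by
    rw [MonoidalCategory.tensorHom_def, whiskerLeft_comp, Category.assoc,
      associator_inv_naturality_right_assoc, whisker_exchange_assoc,
      associator_inv_naturality_middle_assoc, leftUnitor_naturality, comp_whiskerRight_assoc]
  simp only [nestedPairing]
  rw [associator_naturality_right_assoc, ← whiskerLeft_comp_assoc, h]
  simp only [whiskerLeft_comp, Category.assoc]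

variable [RightRigidCategory C]

theorem doubleDualIso_ev {X X' X'' : C} (p : ExactPairing X X') (q : ExactPairing X' X'') :
    (doubleDualIso p q).hom ▷ X' ≫ (Xᘁ)ᘁ ◁ (rightDualIso p inferInstance).hom ≫
      ExactPairing.evaluation Xᘁ (Xᘁ)ᘁ = q.evaluation X' X'' :=
  rightDualIso_ev q (exactPairingCongrLeft (rightDualIso p (inferInstance : ExactPairing X Xᘁ)))

/-- A morphism from `A` to the double dual of `X`, viewed as a pairing `A ⊗ X' ⟶ 1` through a right
dual `X'` of `X`. -/
def pivotalEv {A X X' : C} (δ : A ⟶ (Xᘁ)ᘁ) (p : ExactPairing X X') : A ⊗ X' ⟶ 𝟙_ C :=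
  δ ▷ X' ≫ (Xᘁ)ᘁ ◁ (rightDualIso p inferInstance).hom ≫ ExactPairing.evaluation Xᘁ (Xᘁ)ᘁ

theorem pivotalEv_comp_doubleDualIso {A X X' X'' : C} (δ : A ⟶ X'') (p : ExactPairing X X')
    (q : ExactPairing X' X'') :
    pivotalEv (δ ≫ (doubleDualIso p q).hom) p = δ ▷ X' ≫ q.evaluation X' X'' := by
  rw [pivotalEv, comp_whiskerRight, Category.assoc, doubleDualIso_ev]

theorem pivotalEv_injective {A X X' : C} {δ δ' : A ⟶ (Xᘁ)ᘁ} (p : ExactPairing X X')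
    (h : pivotalEv δ p = pivotalEv δ' p) : δ = δ' := by
  refine ev_ext (inferInstance : ExactPairing Xᘁ (Xᘁ)ᘁ) ?_
  simp only [pivotalEv] at h
  rw [← whisker_exchange_assoc, ← whisker_exchange_assoc, ← whiskerLeftIso_hom,
    cancel_epi] at h
  exact h

theorem comp_pivotalEv {A A' X X' : C} (f : A' ⟶ A) (δ : A ⟶ (Xᘁ)ᘁ) (p : ExactPairing X X') :
    pivotalEv (f ≫ δ) p = f ▷ X' ≫ pivotalEv δ p := by
  simp [pivotalEv]

/-- Composing with a double transpose amounts to composing with a transpose in the second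
variable. -/
theorem pivotalEv_comp_mate {A X X' Y Y' : C} {f : X ⟶ Y} {f' : Y' ⟶ X'} (δ : A ⟶ (Xᘁ)ᘁ)
    (p : ExactPairing X X') (q : ExactPairing Y Y')
    (hf : f' ▷ X ≫ p.evaluation X X' = Y' ◁ f ≫ q.evaluation Y Y') :
    pivotalEv (δ ≫ rightAdjointMate (rightAdjointMate f)) q = A ◁ f' ≫ pivotalEv δ p := by
  have e : f' ≫ (rightDualIso p inferInstance).hom =
      (rightDualIso q inferInstance).hom ≫ rightAdjointMate f := by
    refine ev_ext (inferInstance : ExactPairing X Xᘁ) ?_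
    rw [comp_whiskerRight, comp_whiskerRight, Category.assoc, Category.assoc,
      rightAdjointMate_comp_evaluation, rightDualIso_ev, hf, ← whisker_exchange_assoc,
      rightDualIso_ev]
  simp only [pivotalEv]
  rw [comp_whiskerRight_assoc, ← whisker_exchange_assoc, rightAdjointMate_comp_evaluation,
    whisker_exchange_assoc, ← whiskerLeft_comp_assoc, ← e, whiskerLeft_comp_assoc]

/-- The pairing attached to a natural morphism to the double dual is dinatural. -/
theorem pivotalEv_dinatural {X X' Y Y' : C} {f : X ⟶ Y} {f' : Y' ⟶ X'}
    {δX : X ⟶ (Xᘁ)ᘁ} {δY : Y ⟶ (Yᘁ)ᘁ} (p : ExactPairing X X') (q : ExactPairing Y Y')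
    (hf : f' ▷ X ≫ p.evaluation X X' = Y' ◁ f ≫ q.evaluation Y Y')
    (h : f ≫ δY = δX ≫ rightAdjointMate (rightAdjointMate f)) :
    f ▷ Y' ≫ pivotalEv δY q = X ◁ f' ≫ pivotalEv δX p := by
  rw [← comp_pivotalEv, h, pivotalEv_comp_mate δX p q hf]

/-- Dinaturality of the pairings attached to morphisms to the double duals is naturality. -/
theorem natural_of_pivotalEv {X X' Y Y' : C} {f : X ⟶ Y} {f' : Y' ⟶ X'}
    {δX : X ⟶ (Xᘁ)ᘁ} {δY : Y ⟶ (Yᘁ)ᘁ} (p : ExactPairing X X') (q : ExactPairing Y Y')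
    (hf : f' ▷ X ≫ p.evaluation X X' = Y' ◁ f ≫ q.evaluation Y Y')
    (h : f ▷ Y' ≫ pivotalEv δY q = X ◁ f' ≫ pivotalEv δX p) :
    f ≫ δY = δX ≫ rightAdjointMate (rightAdjointMate f) :=
  pivotalEv_injective q (by rw [comp_pivotalEv, h, pivotalEv_comp_mate δX p q hf])

theorem pivotalEv_congr {A X X₁ X₂ : C} {i : X₁ ⟶ X₂} (δ : A ⟶ (Xᘁ)ᘁ) (p₁ : ExactPairing X X₁)
    (p₂ : ExactPairing X X₂) (hi : i ▷ X ≫ p₂.evaluation X X₂ = p₁.evaluation X X₁) :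
    pivotalEv δ p₁ = A ◁ i ≫ pivotalEv δ p₂ := by
  have := pivotalEv_comp_mate (f := 𝟙 X) (f' := i) δ p₂ p₁ (by simp [hi])
  simpa using this

/-- The identification of double duals is natural. -/
theorem doubleDualIso_naturality {X X' X'' Y Y' Y'' : C} {f : X ⟶ Y} {f' : Y' ⟶ X'}
    {f'' : X'' ⟶ Y''} (p : ExactPairing X X') (p' : ExactPairing X' X'') (q : ExactPairing Y Y')
    (q' : ExactPairing Y' Y'') (hf : f' ▷ X ≫ p.evaluation X X' = Y' ◁ f ≫ q.evaluation Y Y')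
    (hf' : f'' ▷ Y' ≫ q'.evaluation Y' Y'' = X'' ◁ f' ≫ p'.evaluation X' X'') :
    f'' ≫ (doubleDualIso q q').hom =
      (doubleDualIso p p').hom ≫ rightAdjointMate (rightAdjointMate f) := by
  refine pivotalEv_injective q ?_
  have := pivotalEv_comp_doubleDualIso (𝟙 _) p p'
  rw [Category.id_comp] at this
  rw [pivotalEv_comp_doubleDualIso, pivotalEv_comp_mate _ p q hf, this, hf']
  simp

/-- The identification of `X^∨∨ ⊗ Y^∨∨` with the double dual of `X ⊗ Y`. -/
abbrev tensorDoubleDualIso (X Y : C) : (Xᘁ)ᘁ ⊗ (Yᘁ)ᘁ ≅ ((X ⊗ Y)ᘁ)ᘁ :=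
  doubleDualIso (inferInstance : ExactPairing (X ⊗ Y) (Yᘁ ⊗ Xᘁ))
    (inferInstance : ExactPairing (Yᘁ ⊗ Xᘁ) ((Xᘁ)ᘁ ⊗ (Yᘁ)ᘁ))

theorem tensorDoubleDualIso_naturality {X₁ X₂ Y₁ Y₂ : C} (f : X₁ ⟶ X₂) (g : Y₁ ⟶ Y₂) :
    (rightAdjointMate (rightAdjointMate f) ⊗ₘ rightAdjointMate (rightAdjointMate g)) ≫
        (tensorDoubleDualIso X₂ Y₂).hom =
      (tensorDoubleDualIso X₁ Y₁).hom ≫ rightAdjointMate (rightAdjointMate (f ⊗ₘ g)) := by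
  refine doubleDualIso_naturality (f' := rightAdjointMate g ⊗ₘ rightAdjointMate f) _ _ _ _ ?_ ?_
  all_goals
    rw [tensor_evaluation_eq, tensor_evaluation_eq, tensor_nestedPairing_left,
      tensor_nestedPairing_right]
    simp only [rightAdjointMate_comp_evaluation]

/-- Compatibility of a pivotal structure with tensor products, in terms of pairings. -/
theorem pivotalEv_tensor_iff {X Y X' Y' : C} (δX : X ⟶ (Xᘁ)ᘁ) (δY : Y ⟶ (Yᘁ)ᘁ)
    (δ : X ⊗ Y ⟶ ((X ⊗ Y)ᘁ)ᘁ) (p : ExactPairing X X') (q : ExactPairing Y Y') :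
    δ = (δX ⊗ₘ δY) ≫ (tensorDoubleDualIso X Y).hom ↔
    pivotalEv δ (inferInstance : ExactPairing (X ⊗ Y) (Y' ⊗ X')) =
      nestedPairing (pivotalEv δX p) (pivotalEv δY q) := by
  have key : pivotalEv ((δX ⊗ₘ δY) ≫ (tensorDoubleDualIso X Y).hom)
        (inferInstance : ExactPairing (X ⊗ Y) (Y' ⊗ X')) =
      nestedPairing (pivotalEv δX p) (pivotalEv δY q) := by
    rw [pivotalEv_congr (i := (rightDualIso q inferInstance).hom ⊗ₘ
        (rightDualIso p inferInstance).hom) _ _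
      (inferInstance : ExactPairing (X ⊗ Y) (Yᘁ ⊗ Xᘁ)) ?_, pivotalEv_comp_doubleDualIso,
      tensor_evaluation_eq, tensor_nestedPairing_left, tensor_nestedPairing_right]
    · simp only [pivotalEv, whisker_exchange_assoc]
    · rw [tensor_evaluation_eq, tensor_evaluation_eq, tensor_nestedPairing_left,
        rightDualIso_ev, rightDualIso_ev]
  constructor
  · rintro rfl; exact key
  · intro h; exact pivotalEv_injective _ (h.trans key.symm)

variable {D : Type u} [Category.{v} D] [MonoidalCategory D] [RightRigidCategory D]

/-- The identification of `F (X^∨∨)` with the double dual of `F X`. -/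
abbrev mapDoubleDualIso (F : C ⥤ D) [F.Monoidal] (X : C) : F.obj (Xᘁ)ᘁ ≅ ((F.obj X)ᘁ)ᘁ :=
  doubleDualIso (mapExactPairing F (inferInstance : ExactPairing X Xᘁ))
    (mapExactPairing F (inferInstance : ExactPairing Xᘁ (Xᘁ)ᘁ))

open Functor.LaxMonoidal Functor.OplaxMonoidal in
theorem mapDoubleDualIso_naturality (F : C ⥤ D) [F.Monoidal] {X Y : C} (f : X ⟶ Y) :
    F.map (rightAdjointMate (rightAdjointMate f)) ≫ (mapDoubleDualIso F Y).hom =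
      (mapDoubleDualIso F X).hom ≫ rightAdjointMate (rightAdjointMate (F.map f)) := by
  refine doubleDualIso_naturality (f' := F.map (rightAdjointMate f)) _ _ _ _ ?_ ?_
  all_goals
    change _ ≫ μ F _ _ ≫ F.map (ExactPairing.evaluation _ _) ≫ η F =
      _ ≫ μ F _ _ ≫ F.map (ExactPairing.evaluation _ _) ≫ η F
    rw [μ_natural_left_assoc, μ_natural_right_assoc, ← Functor.map_comp_assoc,
      ← Functor.map_comp_assoc, rightAdjointMate_comp_evaluation]

open Functor.LaxMonoidal Functor.OplaxMonoidal in
/-- A monoidal functor is pivotal if it preserves the pairings attached to the pivotal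
structures. -/
theorem pivotalEv_map_iff (F : C ⥤ D) [F.Monoidal] {X X' : C} (δX : X ⟶ (Xᘁ)ᘁ)
    (δ : F.obj X ⟶ ((F.obj X)ᘁ)ᘁ) (p : ExactPairing X X') :
    δ = F.map δX ≫ (mapDoubleDualIso F X).hom ↔
    pivotalEv δ (mapExactPairing F p) = μ F X X' ≫ F.map (pivotalEv δX p) ≫ η F := by
  have key : pivotalEv (F.map δX ≫ (mapDoubleDualIso F X).hom)
        (mapExactPairing F p) = μ F X X' ≫ F.map (pivotalEv δX p) ≫ η F := by
    rw [pivotalEv_congr (i := F.map (rightDualIso p inferInstance).hom) _ _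
      (mapExactPairing F (inferInstance : ExactPairing X Xᘁ)) ?_, pivotalEv_comp_doubleDualIso,
      whisker_exchange_assoc]
    · change _ ≫ _ ≫ μ F _ _ ≫ F.map (ExactPairing.evaluation Xᘁ (Xᘁ)ᘁ) ≫ η F = _
      simp only [pivotalEv, Functor.map_comp, Category.assoc, μ_natural_left_assoc,
        μ_natural_right_assoc]
    · change _ ≫ μ F _ _ ≫ F.map (ExactPairing.evaluation X Xᘁ) ≫ η F =
        μ F _ _ ≫ F.map (p.evaluation X X') ≫ η F
      rw [μ_natural_left_assoc, ← Functor.map_comp_assoc, rightDualIso_ev]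
  constructor
  · rintro rfl; exact key
  · intro h; exact pivotalEv_injective _ (h.trans key.symm)

end Pairings

section Preadditive

variable {C : Type u} [Category.{v} C] [Preadditive C] [MonoidalCategory C]
  [MonoidalPreadditive C] [RightRigidCategory C]

variable (C) in
/-- The double dual functor. -/
@[simps]
def doubleDualFunctor : C ⥤ C where
  obj X := (Xᘁ)ᘁ
  map f := rightAdjointMate (rightAdjointMate f)
  map_comp f g := by simp [comp_rightAdjointMate]

instance doubleDualFunctor_additive : (doubleDualFunctor C).Additive where
  map_add {X Y f g} := by
    have h (X Y : C) (f g : X ⟶ Y) :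
        rightAdjointMate (f + g) = rightAdjointMate f + rightAdjointMate g := by
      simp [rightAdjointMate]
    exact (congrArg _ (h _ _ f g)).trans (h _ _ _ _)

end Preadditive

/-! ### The opposite product -/

section ReverseMonoidal

variable (C : Type u) [Category.{v} C] [MonoidalCategory C]

/-- The monoidal structure on `C` with the opposite product `(X, Y) ↦ Y ⊗ X`. Unlike on Mathlib's
`Cᴹᵒᵖ`, the underlying category is `C` itself. -/
@[reducible]
def reverseMonoidal : MonoidalCategory C where
  tensorObj X Y := Y ⊗ X
  whiskerLeft X _ _ f := f ▷ X
  whiskerRight f X := X ◁ f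
  tensorHom f g := g ⊗ₘ f
  tensorHom_def f g := MonoidalCategory.tensorHom_def' g f
  tensorHom_comp_tensorHom f g h i := by simp
  tensorUnit := 𝟙_ C
  associator X Y Z := (α_ Z Y X).symm
  leftUnitor X := ρ_ X
  rightUnitor X := λ_ X
  associator_naturality f g h := by simp
  leftUnitor_naturality f := by simp
  rightUnitor_naturality f := by simp
  triangle X Y := by simp
  pentagon W X Y Z := by simp

variable {C}

/-- Duals for the opposite product are duals on the other side. -/
@[reducible]
def reversePairing {X Y : C} (p : ExactPairing Y X) : @ExactPairing C _ (reverseMonoidal C) X Y :=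
  @ExactPairing.mk C _ (reverseMonoidal C) X Y (p.coevaluation Y X) (p.evaluation Y X)
    (p.evaluation_coevaluation Y X) (p.coevaluation_evaluation Y X)

variable (C) in
/-- The opposite product of a rigid category is rigid: left and right duals are exchanged. -/
@[reducible]
def reverseRigid [RigidCategory C] : @RigidCategory C _ (reverseMonoidal C) :=
  @RigidCategory.mk C _ (reverseMonoidal C)
    (@RightRigidCategory.mk C _ (reverseMonoidal C) fun X =>
      @HasRightDual.mk C _ (reverseMonoidal C) X (ᘁX : C)
        (reversePairing (inferInstance : ExactPairing (ᘁX : C) X)))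
    (@LeftRigidCategory.mk C _ (reverseMonoidal C) fun X =>
      @HasLeftDual.mk C _ (reverseMonoidal C) X Xᘁ
        (reversePairing (inferInstance : ExactPairing X Xᘁ)))

open Functor.LaxMonoidal in
/-- A lax monoidal functor is lax monoidal for the opposite products. -/
@[reducible]
def reverseLaxMonoidal (F : C ⥤ C) [F.LaxMonoidal] :
    @Functor.LaxMonoidal C _ (reverseMonoidal C) C _ (reverseMonoidal C) F :=
  @Functor.LaxMonoidal.mk C _ (reverseMonoidal C) C _ (reverseMonoidal C) F
    (ε F) (fun X Y => μ F Y X) (fun f _ => μ_natural_right F _ f)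
    (fun _ f => μ_natural_left F f _) (fun X Y Z => Functor.LaxMonoidal.associativity_inv F Z Y X)
    (fun _ => right_unitality F _) (fun _ => left_unitality F _)

/-- A monoidal natural transformation is monoidal for the opposite products. -/
theorem reverse_isMonoidal {F₁ F₂ : C ⥤ C} [F₁.LaxMonoidal] [F₂.LaxMonoidal] (τ : F₁ ⟶ F₂)
    [h : NatTrans.IsMonoidal τ] :
    @NatTrans.IsMonoidal C _ (reverseMonoidal C) C _ (reverseMonoidal C) F₁ F₂ τ
      (reverseLaxMonoidal F₁) (reverseLaxMonoidal F₂) :=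
  @NatTrans.IsMonoidal.mk C _ (reverseMonoidal C) C _ (reverseMonoidal C) F₁ F₂ τ
    (reverseLaxMonoidal F₁) (reverseLaxMonoidal F₂) h.unit fun X Y => h.tensor Y X

open Functor.LaxMonoidal Functor.OplaxMonoidal Functor.Monoidal in
/-- A monoidal functor is monoidal for the opposite products. -/
@[reducible]
def reverseFunctorMonoidal (F : C ⥤ C) [F.Monoidal] :
    @Functor.Monoidal C _ (reverseMonoidal C) C _ (reverseMonoidal C) F :=
  @Functor.Monoidal.mk C _ (reverseMonoidal C) C _ (reverseMonoidal C) F (reverseLaxMonoidal F)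
    (@Functor.OplaxMonoidal.mk C _ (reverseMonoidal C) C _ (reverseMonoidal C) F
      (η F) (fun X Y => δ F Y X) (fun f _ => δ_natural_right F _ f)
      (fun _ f => δ_natural_left F f _)
      (fun X Y Z => Functor.OplaxMonoidal.associativity_inv F Z Y X)
      (fun _ => oplax_right_unitality F _) (fun _ => oplax_left_unitality F _))
    (ε_η F) (η_ε F) (fun X Y => μ_δ F Y X) (fun X Y => δ_μ F Y X)

end ReverseMonoidal

section ReverseMultitensor

variable (k : Type w) (C : Type u) [Field k] [Category.{v} C] [Abelian C]
    [Linear k C] [M : MultitensorCategory k C]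

/-- The multitensor structure with the opposite product. -/
@[reducible]
def reverseMultitensor : MultitensorCategory k C :=
  { M.toLocallyFinite, reverseMonoidal C, reverseRigid C with
    whiskerLeft_zero := MonoidalPreadditive.zero_whiskerRight (C := C)
    zero_whiskerRight := MonoidalPreadditive.whiskerLeft_zero (C := C)
    whiskerLeft_add := MonoidalPreadditive.add_whiskerRight (C := C)
    add_whiskerRight := MonoidalPreadditive.whiskerLeft_add (C := C)
    whiskerLeft_smul := fun X _ _ r f => MonoidalLinear.smul_whiskerRight (C := C) r f X
    smul_whiskerRight := fun r _ _ f X => MonoidalLinear.whiskerLeft_smul (C := C) X r f }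

end ReverseMultitensor

/-! ### Gradings -/

section Grading

variable {G : Type t} {C : Type u} [Group G] [Category.{v} C] [Abelian C]

attribute [local instance] Abelian.hasFiniteBiproducts

section

variable [MonoidalCategory C] {P : G → ObjectProperty C} (hP : IsGGrading P)
include hP

theorem IsGGrading.exists_decomposition (Y : C) :
    ∃ (S : Finset G) (X : S → C) (ι : ∀ g, X g ⟶ Y) (π : ∀ g, Y ⟶ X g),
      (∀ g : S, P g (X g)) ∧ (∀ g, ι g ≫ π g = 𝟙 (X g)) ∧ ∑ g, π g ≫ ι g = 𝟙 Y := by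
  classical
  obtain ⟨S, X, hX, ⟨e⟩⟩ := hP.decomposition Y
  refine ⟨S, X, fun g => biproduct.ι X g ≫ e.inv, fun g => e.hom ≫ biproduct.π X g, hX,
    fun g => by simp, ?_⟩
  have : ∑ g, (e.hom ≫ biproduct.π X g) ≫ biproduct.ι X g ≫ e.inv =
      e.hom ≫ (∑ g, biproduct.π X g ≫ biproduct.ι X g) ≫ e.inv := by
    simp [Preadditive.comp_sum, Preadditive.sum_comp]
  have t : ∑ g, biproduct.π X g ≫ biproduct.ι X g = 𝟙 (⨁ X) :=
    IsBilimit.total (biproduct.isBilimit X)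
  rw [this, t]
  simp

/-- An object receiving no nonzero morphism from the other components lies in `C_h`. -/
theorem IsGGrading.mem_of_hom_eq_zero {h : G} {Y : C}
    (hY : ∀ {g : G} {Z : C}, g ≠ h → P g Z → ∀ f : Z ⟶ Y, f = 0) : P h Y := by
  classical
  obtain ⟨S, X, hX, ⟨e⟩⟩ := hP.decomposition Y
  have := hP.iso h
  have := hP.finiteProducts h
  have := hP.zero h
  have hXh (g : S) : P h (X g) := by
    by_cases hg : (g : G) = h
    · exact hg ▸ hX g
    · refine (P h).prop_of_isZero ((IsZero.iff_id_eq_zero _).2 ?_)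
      have h0 := hY hg (hX g) (biproduct.ι X g ≫ e.inv)
      have h1 : (biproduct.ι X g ≫ e.inv) ≫ e.hom ≫ biproduct.π X g = 𝟙 (X g) := by simp
      rw [← h1, h0, zero_comp]
  refine (P h).prop_of_iso (e ≪≫ biproduct.isoProduct X).symm ?_
  exact ObjectProperty.prop_pi _ _ hXh

/-- A morphism from the image of an additive functor is determined on homogeneous objects. -/
theorem IsGGrading.hom_ext {D : Type*} [Category* D] [Preadditive D] (T : C ⥤ D) [T.Additive]
    {Y : C} {Z : D} {f f' : T.obj Y ⟶ Z}
    (h : ∀ {g : G} {X : C}, P g X → ∀ i : X ⟶ Y, T.map i ≫ f = T.map i ≫ f') : f = f' := by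
  obtain ⟨S, X, ι, π, hX, -, hπ⟩ := hP.exists_decomposition Y
  have e (k : T.obj Y ⟶ Z) : k = ∑ g, T.map (π g) ≫ T.map (ι g) ≫ k := by
    calc
      k = T.map (∑ g, π g ≫ ι g) ≫ k := by rw [hπ]; simp
      _ = _ := by simp [Functor.map_sum, Preadditive.sum_comp]
  rw [e f, e f']
  exact Finset.sum_congr rfl fun g _ => by rw [h (hX g)]

/-- A natural isomorphism from the identity to an additive functor can be prescribed on the
homogeneous objects. -/
theorem IsGGrading.exists_natural_extension (F : C ⥤ C) [F.Additive]
    (φ : ∀ {g : G} {X : C}, P g X → (X ≅ F.obj X))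
    (hφ : ∀ {g : G} {X Y : C} (hX : P g X) (hY : P g Y) (f : X ⟶ Y),
      f ≫ (φ hY).hom = (φ hX).hom ≫ F.map f) :
    ∃ Φ : ∀ X : C, X ≅ F.obj X,
      (∀ {X Y : C} (f : X ⟶ Y), f ≫ (Φ Y).hom = (Φ X).hom ≫ F.map f) ∧
      ∀ {g : G} {X : C} (hX : P g X), (Φ X).hom = (φ hX).hom := by
  classical
  have hφ' {g h : G} {X Y : C} (hX : P g X) (hY : P h Y) (f : X ⟶ Y) :
      f ≫ (φ hY).hom = (φ hX).hom ≫ F.map f := by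
    by_cases hgh : g = h
    · subst hgh; exact hφ hX hY f
    · rw [hP.hom_eq_zero hgh hX hY f]; simp
  choose S X ι π hX hιπ hπι using hP.exists_decomposition
  -- The extension is the sum of its components; `a Y` does not depend on the decomposition by `ha`.
  let a (Y : C) : Y ⟶ F.obj Y := ∑ g, π Y g ≫ (φ (hX Y g)).hom ≫ F.map (ι Y g)
  have ha {g : G} {Z Y : C} (hZ : P g Z) (f : Z ⟶ Y) : f ≫ a Y = (φ hZ).hom ≫ F.map f := by
    calc
      f ≫ a Y = ∑ g, (φ hZ).hom ≫ F.map (f ≫ π Y g ≫ ι Y g) := by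
        simp only [a, Preadditive.comp_sum]
        refine Finset.sum_congr rfl fun g _ => ?_
        rw [← Category.assoc, ← Category.assoc, hφ' hZ]
        simp
      _ = _ := by
        rw [← Preadditive.comp_sum, ← Functor.map_sum, ← Preadditive.comp_sum, hπι,
          Category.comp_id]
  let b (Y : C) : F.obj Y ⟶ Y := ∑ g, F.map (π Y g) ≫ (φ (hX Y g)).inv ≫ ι Y g
  have hab (Y : C) : a Y ≫ b Y = 𝟙 Y := by
    refine hP.hom_ext (𝟭 C) fun {g Z} hZ i => ?_
    calc
      i ≫ a Y ≫ b Y = ∑ g, ((φ hZ).hom ≫ F.map (i ≫ π Y g)) ≫ (φ (hX Y g)).inv ≫ ι Y g := by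
        rw [← Category.assoc, ha hZ]
        simp only [b, Preadditive.comp_sum]
        exact Finset.sum_congr rfl fun g _ => by simp
      _ = ∑ g, i ≫ π Y g ≫ ι Y g :=
        Finset.sum_congr rfl fun g _ => by rw [← hφ' hZ (hX Y g)]; simp
      _ = _ := by rw [← Preadditive.comp_sum, hπι]; rfl
  have hba (Y : C) : b Y ≫ a Y = 𝟙 (F.obj Y) := by
    calc
      b Y ≫ a Y = ∑ g, F.map (π Y g) ≫ (φ (hX Y g)).inv ≫ ι Y g ≫ a Y := by
        simp [b, Preadditive.sum_comp]
      _ = ∑ g, F.map (π Y g ≫ ι Y g) :=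
        Finset.sum_congr rfl fun g _ => by rw [ha (hX Y g)]; simp
      _ = _ := by rw [← Functor.map_sum, hπι, F.map_id]
  refine ⟨fun Y => ⟨a Y, b Y, hab Y, hba Y⟩, fun {X Y} f => ?_, fun {g X} hX => ?_⟩
  · refine hP.hom_ext (𝟭 C) fun {g Z} hZ i => ?_
    change i ≫ f ≫ a Y = i ≫ a X ≫ F.map f
    rw [← Category.assoc, ha hZ, ← Category.assoc, ha hZ]
    simp
  · simpa using ha hX (𝟙 X)

/-- The unit object lies in the neutral component. -/
theorem IsGGrading.unit_mem : P 1 (𝟙_ C) := by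
  refine hP.mem_of_hom_eq_zero fun {g Z} hg hZ f => ?_
  obtain ⟨S, X, ι, π, hX, hιπ, hπι⟩ := hP.exists_decomposition (𝟙_ C)
  -- The idempotent `p` of `1` with image `X a` satisfies `p = p ≫ p = p ⊗ p` under `1 ⊗ 1 ≅ 1`.
  -- Hence it factors through `X a ⊗ X a`, and vanishes unless `a * a = a`.
  have h0 (a : S) (ha : (a : G) ≠ 1) : ι a = 0 := by
    have h1 : ι a ≫ (λ_ (𝟙_ C)).inv ≫ (π a ⊗ₘ π a) = 0 :=
      hP.hom_eq_zero (by simpa [eq_comm] using ha) (hX a) (hP.tensor (hX a) (hX a)) _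
    have h2 : (λ_ (𝟙_ C)).inv ≫ ((π a ≫ ι a) ⊗ₘ (π a ≫ ι a)) ≫ (λ_ (𝟙_ C)).hom =
        (π a ≫ ι a) ≫ (π a ≫ ι a) := by
      simp [MonoidalCategory.tensorHom_def, unitors_equal, unitors_inv_equal]
    have h3 : (π a ≫ ι a) ≫ (π a ≫ ι a) = π a ≫ ι a := by
      rw [Category.assoc, reassoc_of% hιπ a]
    calc
      ι a = ι a ≫ (π a ≫ ι a) ≫ (π a ≫ ι a) := by rw [h3, reassoc_of% hιπ a]
      _ = (ι a ≫ (λ_ (𝟙_ C)).inv ≫ (π a ⊗ₘ π a)) ≫ (ι a ⊗ₘ ι a) ≫ (λ_ (𝟙_ C)).hom := by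
        rw [← h2]; simp
      _ = 0 := by rw [h1, zero_comp]
  rw [← Category.comp_id f, ← hπι, Preadditive.comp_sum]
  refine Finset.sum_eq_zero fun a _ => ?_
  by_cases ha : (a : G) = 1
  · rw [← Category.assoc, hP.hom_eq_zero (fun e => hg (e.trans ha)) hZ (hX a) (f ≫ π a), zero_comp]
  · rw [h0 a ha, comp_zero, comp_zero]

/-- A dual of an object of `C_h` lies in `C_{h⁻¹}`: the evaluation vanishes on `Z ⊗ X` for `Z` in
any other component, so that there is no nonzero morphism from `Z` to the dual. -/
theorem IsGGrading.dual_mem [MonoidalPreadditive C] {h : G} {X X' : C} (p : ExactPairing X X')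
    (hX : P h X) : P h⁻¹ X' := by
  refine hP.mem_of_hom_eq_zero fun {g Z} hg hZ f => ?_
  have h0 : f ▷ X ≫ p.evaluation X X' = 0 :=
    hP.hom_eq_zero (fun e => hg (eq_inv_of_mul_eq_one_left e)) (hP.tensor hZ hX) hP.unit_mem _
  exact ev_ext p (by rw [h0]; simp)

end

end Grading

/-! ### Coherence of the action -/

section Action

variable {k : Type w} {G : Type t} {C : Type u} [Field k] [Group G] [Category.{v} C] [Abelian C]
  [Linear k C] (A : GAction k G C)

theorem GAction.mulIso_naturality {g h l : G} (e : g * h = l) {X Y : C} (f : X ⟶ Y) :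
    (A.act g).map ((A.act h).map f) ≫ (A.mulIso e Y).hom =
      (A.mulIso e X).hom ≫ (A.act l).map f := by
  subst e
  simpa [mulIso] using (A.mul g h).hom.naturality f

theorem GAction.mulIso_assoc {g h l a b c : G} (e₁ : h * l = a) (e₂ : g * a = b) (e₃ : g * h = c)
    (e₄ : c * l = b) (X : C) :
    (A.act g).map (A.mulIso e₁ X).hom ≫ (A.mulIso e₂ X).hom =
      (A.mulIso e₃ ((A.act l).obj X)).hom ≫ (A.mulIso e₄ X).hom := by
  subst e₁ e₂ e₃
  simpa [mulIso] using A.assoc g h l X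

theorem GAction.oneIso_naturality {X Y : C} (f : X ⟶ Y) :
    (A.act 1).map f ≫ (A.oneIso Y).hom = (A.oneIso X).hom ≫ f := by
  simp [oneIso]

theorem GAction.mulIso_one_left {g : G} (e : 1 * g = g) (X : C) :
    (A.mulIso e X).hom = (A.oneIso ((A.act g).obj X)).hom := by
  rw [← cancel_epi (A.oneIso ((A.act g).obj X)).inv, Iso.inv_hom_id]
  have h := A.one_left g X
  simp only [oneIso, mulIso, Iso.symm_inv, Iso.trans_hom, Iso.app_hom, eqToIso.hom]
  rw [reassoc_of% h]
  simp

theorem GAction.mulIso_one_right {g : G} (e : g * 1 = g) (X : C) :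
    (A.mulIso e X).hom = (A.act g).map (A.oneIso X).hom := by
  rw [← cancel_epi ((A.act g).map (A.oneIso X).inv), ← Functor.map_comp, Iso.inv_hom_id]
  have h := A.one_right g X
  simp only [oneIso, mulIso, Iso.symm_inv, Iso.trans_hom, Iso.app_hom, eqToIso.hom]
  rw [reassoc_of% h]
  simp

theorem GAction.cancelIso_hom {g h : G} (e : g * h = 1) (X : C) :
    (A.cancelIso e X).hom = (A.mulIso e X).hom ≫ (A.oneIso X).hom := rfl

theorem GAction.cancelIso_naturality {g h : G} (e : g * h = 1) {X Y : C} (f : X ⟶ Y) :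
    (A.act g).map ((A.act h).map f) ≫ (A.cancelIso e Y).hom = (A.cancelIso e X).hom ≫ f := by
  simp only [cancelIso_hom, reassoc_of% mulIso_naturality, oneIso_naturality, Category.assoc]

/-- Cancelling `g h = e` after multiplying `h b = a`. -/
theorem GAction.map_mulIso_mulIso {g h a b : G} (e : g * h = 1) (e₁ : h * b = a) (e₂ : g * a = b)
    (X : C) :
    (A.act g).map (A.mulIso e₁ X).hom ≫ (A.mulIso e₂ X).hom =
      (A.cancelIso e ((A.act b).obj X)).hom := by
  rw [A.mulIso_assoc e₁ e₂ e (one_mul b), mulIso_one_left, cancelIso_hom]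

/-- Multiplying and then cancelling is cancelling twice. -/
theorem GAction.map_mulIso_cancelIso {g h a b c : G} (e₁ : h * b = a) (e₂ : g * a = 1)
    (e₃ : g * h = c) (e₄ : c * b = 1) (X : C) :
    (A.act g).map (A.mulIso e₁ X).hom ≫ (A.cancelIso e₂ X).hom =
      (A.mulIso e₃ ((A.act b).obj X)).hom ≫ (A.cancelIso e₄ X).hom := by
  simp only [cancelIso_hom]
  rw [reassoc_of% A.mulIso_assoc e₁ e₂ e₃ e₄]

/-- Multiplying twice to cancel `h l = e` on the right. -/
theorem GAction.mulIso_mulIso {g h l c : G} (e : h * l = 1) (e₁ : g * h = c) (e₂ : c * l = g)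
    (X : C) :
    (A.mulIso e₁ ((A.act l).obj X)).hom ≫ (A.mulIso e₂ X).hom =
      (A.act g).map (A.cancelIso e X).hom := by
  rw [← A.mulIso_assoc e (mul_one g), mulIso_one_right, cancelIso_hom, Functor.map_comp]

/-- `^g(^h(^g X)) ≅ ^g X` can be formed by cancelling on either side. -/
theorem GAction.map_cancelIso {g h : G} (e : g * h = 1) (e' : h * g = 1) (X : C) :
    (A.act g).map (A.cancelIso e' X).hom = (A.cancelIso e ((A.act g).obj X)).hom := by
  rw [← A.map_mulIso_mulIso e e' (mul_one g), mulIso_one_right, cancelIso_hom, Functor.map_comp]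

end Action

section Crossed

variable {k : Type w} {G : Type t} {C : Type u} [Field k] [Group G] [Category.{v} C] [Abelian C]
  [Linear k C] [MultitensorCategory k C] {A : GAction k G C} {P : G → ObjectProperty C}
  (B : GBraided A P)

open Functor.LaxMonoidal Functor.OplaxMonoidal

theorem GBraided.actTensorIso_naturality_left (g : G) {X X' : C} (f : X ⟶ X') (Y : C) :
    (A.act g).map f ▷ (A.act g).obj Y ≫ (B.actTensorIso g X' Y).hom =
      (B.actTensorIso g X Y).hom ≫ (A.act g).map (f ▷ Y) := by
  let _ := B.monoidal g
  exact μ_natural_left (A.act g) f Y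

theorem GBraided.actTensorIso_inv_naturality_left (g : G) {X X' : C} (f : X ⟶ X') (Y : C) :
    (A.act g).map (f ▷ Y) ≫ (B.actTensorIso g X' Y).inv =
      (B.actTensorIso g X Y).inv ≫ (A.act g).map f ▷ (A.act g).obj Y := by
  rw [Iso.comp_inv_eq, Category.assoc, actTensorIso_naturality_left, Iso.inv_hom_id_assoc]

theorem GBraided.actTensorIso_naturality_right (g : G) (X : C) {Y Y' : C} (f : Y ⟶ Y') :
    (A.act g).obj X ◁ (A.act g).map f ≫ (B.actTensorIso g X Y').hom =
      (B.actTensorIso g X Y).hom ≫ (A.act g).map (X ◁ f) := by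
  let _ := B.monoidal g
  exact μ_natural_right (A.act g) X f

theorem GBraided.actTensorIso_assoc (g : G) (X Y Z : C) :
    (B.actTensorIso g X Y).hom ▷ (A.act g).obj Z ≫ (B.actTensorIso g (X ⊗ Y) Z).hom ≫
        (A.act g).map (α_ X Y Z).hom =
      (α_ _ _ _).hom ≫ (A.act g).obj X ◁ (B.actTensorIso g Y Z).hom ≫
        (B.actTensorIso g X (Y ⊗ Z)).hom := by
  let _ := B.monoidal g
  exact associativity (A.act g) X Y Z

theorem GBraided.actUnitIso_left (g : G) (X : C) :
    (B.actUnitIso g).hom ▷ (A.act g).obj X ≫ (B.actTensorIso g (𝟙_ C) X).hom ≫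
      (A.act g).map (λ_ X).hom = (λ_ _).hom := by
  let _ := B.monoidal g
  exact (Functor.LaxMonoidal.left_unitality (A.act g) X).symm

/-- The action isomorphism `^g(^h -) ≅ ^l -` is monoidal. -/
theorem GBraided.mulIso_tensor {g h l : G} (e : g * h = l) (X Y : C) :
    (B.actTensorIso g _ _).hom ≫ (A.act g).map (B.actTensorIso h X Y).hom ≫
        (A.mulIso e (X ⊗ Y)).hom =
      ((A.mulIso e X).hom ⊗ₘ (A.mulIso e Y).hom) ≫ (B.actTensorIso l X Y).hom := by
  subst e
  let _ := B.monoidal g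
  let _ := B.monoidal h
  let _ := B.monoidal (g * h)
  have := B.mul_isMonoidal g h
  have := this.tensor X Y
  simpa [GAction.mulIso, actTensorIso, actUnitIso] using this

theorem GBraided.mulIso_unit {g h l : G} (e : g * h = l) :
    (B.actUnitIso g).hom ≫ (A.act g).map (B.actUnitIso h).hom ≫ (A.mulIso e (𝟙_ C)).hom =
      (B.actUnitIso l).hom := by
  subst e
  let _ := B.monoidal g
  let _ := B.monoidal h
  let _ := B.monoidal (g * h)
  have := B.mul_isMonoidal g h
  have := this.unit
  simpa [GAction.mulIso, actTensorIso, actUnitIso] using this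

theorem GBraided.oneIso_tensor (X Y : C) :
    (B.actTensorIso 1 X Y).hom ≫ (A.oneIso (X ⊗ Y)).hom =
      (A.oneIso X).hom ⊗ₘ (A.oneIso Y).hom := by
  let _ := B.monoidal 1
  have := B.one_isMonoidal
  have h := this.tensor X Y
  rw [← cancel_epi (A.one.hom.app X ⊗ₘ A.one.hom.app Y)]
  simp only [actTensorIso, Functor.Monoidal.μIso_hom, ← reassoc_of% h, GAction.oneIso]
  simp

theorem GBraided.actUnitIso_oneIso :
    (B.actUnitIso 1).hom ≫ (A.oneIso (𝟙_ C)).hom = 𝟙 _ := by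
  let _ := B.monoidal 1
  have := B.one_isMonoidal
  have h := this.unit
  simp only [actUnitIso, Functor.Monoidal.εIso_hom, ← h, GAction.oneIso]
  simp

theorem GBraided.cancelIso_tensor {g h : G} (e : g * h = 1) (X Y : C) :
    (B.actTensorIso g _ _).hom ≫ (A.act g).map (B.actTensorIso h X Y).hom ≫
        (A.cancelIso e (X ⊗ Y)).hom =
      (A.cancelIso e X).hom ⊗ₘ (A.cancelIso e Y).hom := by
  simp only [GAction.cancelIso_hom, reassoc_of% B.mulIso_tensor, oneIso_tensor,
    tensorHom_comp_tensorHom]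

theorem GBraided.cancelIso_unit {g h : G} (e : g * h = 1) :
    (B.actUnitIso g).hom ≫ (A.act g).map (B.actUnitIso h).hom ≫ (A.cancelIso e (𝟙_ C)).hom =
      𝟙 _ := by
  simp only [GAction.cancelIso_hom, reassoc_of% B.mulIso_unit, actUnitIso_oneIso]

end Crossed

/-! ### Coherence of the braiding -/

section Braided

variable {k : Type w} {G : Type t} {C : Type u} [Field k] [Group G] [Category.{v} C] [Abelian C]
  [Linear k C] [MultitensorCategory k C] {A : GAction k G C} {P : G → ObjectProperty C}
  (B : GBraided A P)

theorem GBraided.braiding_naturality_right {g : G} {X : C} (hX : P g X) {Y Y' : C} (f : Y ⟶ Y') :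
    X ◁ f ≫ (B.braiding hX Y').hom = (B.braiding hX Y).hom ≫ (A.act g).map f ▷ X := by
  simpa using B.braiding_naturality hX hX (𝟙 X) f

theorem GBraided.braiding_naturality_left {g : G} {X X' : C} (hX : P g X) (hX' : P g X')
    (f : X ⟶ X') (Y : C) :
    f ▷ Y ≫ (B.braiding hX' Y).hom = (B.braiding hX Y).hom ≫ (A.act g).obj Y ◁ f := by
  simpa using B.braiding_naturality hX hX' f (𝟙 Y)

/-- `GBraided.braiding_tensor_left` with the degree of the product as a parameter. -/
theorem GBraided.braiding_tensor_left' {g₁ g₂ l : G} (e : g₁ * g₂ = l) {X₁ X₂ : C} (h₁ : P g₁ X₁)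
    (h₂ : P g₂ X₂) (h : P l (X₁ ⊗ X₂)) (Y : C) :
    (B.braiding h Y).hom =
      (α_ X₁ X₂ Y).hom ≫ X₁ ◁ (B.braiding h₂ Y).hom ≫ (α_ X₁ ((A.act g₂).obj Y) X₂).inv ≫
        (B.braiding h₁ ((A.act g₂).obj Y)).hom ▷ X₂ ≫ (A.mulIso e Y).hom ▷ X₁ ▷ X₂ ≫
          (α_ ((A.act l).obj Y) X₁ X₂).hom := by
  subst e
  exact B.braiding_tensor_left h₁ h₂ Y

/-- `GBraided.braiding_tensor_right` in terms of `GBraided.actTensorIso`. -/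
theorem GBraided.braiding_tensor_right' {g : G} {X : C} (hX : P g X) (Y₁ Y₂ : C) :
    (B.braiding hX (Y₁ ⊗ Y₂)).hom =
      (α_ X Y₁ Y₂).inv ≫ (B.braiding hX Y₁).hom ▷ Y₂ ≫ (α_ ((A.act g).obj Y₁) X Y₂).hom ≫
        (A.act g).obj Y₁ ◁ (B.braiding hX Y₂).hom ≫
          (α_ ((A.act g).obj Y₁) ((A.act g).obj Y₂) X).inv ≫ (B.actTensorIso g Y₁ Y₂).hom ▷ X :=
  B.braiding_tensor_right hX Y₁ Y₂

/-- `GBraided.braiding_act` with the degrees as parameters. -/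
theorem GBraided.braiding_act' {a g m g' : G} {X : C} (hX : P g X)
    (hX' : P g' ((A.act a).obj X)) (e : a * g = m) (e' : g' * a = m) (Y : C) :
    (B.actTensorIso a X Y).hom ≫ (A.act a).map (B.braiding hX Y).hom ≫
        (B.actTensorIso a ((A.act g).obj Y) X).inv ≫ (A.mulIso e Y).hom ▷ (A.act a).obj X =
      (B.braiding hX' ((A.act a).obj Y)).hom ≫ (A.mulIso e' Y).hom ▷ (A.act a).obj X := by
  have e₀ : g' = a * g * a⁻¹ := by rw [e, ← e']; group
  subst e e₀
  exact B.braiding_act a hX Y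

/-- The `G`-braiding with the unit is canonical. This follows from `1 ⊗ 1 ≅ 1`, since the braiding
is invertible. -/
theorem GBraided.braiding_unit_right {g : G} {X : C} (hX : P g X) :
    (B.braiding hX (𝟙_ C)).hom = (ρ_ X).hom ≫ (λ_ X).inv ≫ (B.actUnitIso g).hom ▷ X := by
  -- In terms of `a`, which is to be the unitor, naturality along `1 ⊗ 1 ≅ 1` says that `a` and the
  -- unitor agree after tensoring with `1`.
  obtain ⟨a, hb⟩ : ∃ a : X ⊗ 𝟙_ C ≅ X,
      (B.braiding hX (𝟙_ C)).hom = a.hom ≫ (λ_ X).inv ≫ (B.actUnitIso g).hom ▷ X :=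
    ⟨B.braiding hX (𝟙_ C) ≪≫ whiskerRightIso (B.actUnitIso g).symm X ≪≫ λ_ X, by simp⟩
  have h₁ := B.braiding_naturality_right hX (λ_ (𝟙_ C)).hom
  have h₂ : ((B.actUnitIso g).hom ⊗ₘ (B.actUnitIso g).hom) ≫ (B.actTensorIso g _ _).hom ≫
      (A.act g).map (λ_ (𝟙_ C)).hom = (λ_ (𝟙_ C)).hom ≫ (B.actUnitIso g).hom := by
    rw [MonoidalCategory.tensorHom_def', Category.assoc, B.actUnitIso_left, leftUnitor_naturality]
  have h₃ : (ρ_ X).hom ▷ 𝟙_ C = a.hom ▷ 𝟙_ C := by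
    rw [← cancel_epi (α_ _ _ _).inv, ← cancel_mono (a.hom ≫ (λ_ X).inv ≫ (B.actUnitIso g).hom ▷ X)]
    calc
      _ = X ◁ (λ_ (𝟙_ C)).hom ≫ (B.braiding hX (𝟙_ C)).hom := by rw [hb]; monoidal
      _ = (α_ _ _ _).inv ≫ (a.hom ≫ (λ_ X).inv) ▷ 𝟙_ C ≫ (α_ _ _ _).hom ≫
          (B.actUnitIso g).hom ▷ (X ⊗ 𝟙_ C) ≫ (A.act g).obj (𝟙_ C) ◁ (a.hom ≫ (λ_ X).inv ≫
          (B.actUnitIso g).hom ▷ X) ≫ (α_ _ _ _).inv ≫ ((B.actTensorIso g _ _).hom ≫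
            (A.act g).map (λ_ (𝟙_ C)).hom) ▷ X := by
        rw [h₁, B.braiding_tensor_right', hb]; simp
      _ = (α_ _ _ _).inv ≫ (a.hom ≫ (λ_ X).inv) ▷ 𝟙_ C ≫ (α_ _ _ _).hom ≫
          𝟙_ C ◁ (a.hom ≫ (λ_ X).inv) ≫ (α_ _ _ _).inv ≫
          (((B.actUnitIso g).hom ⊗ₘ (B.actUnitIso g).hom) ≫ (B.actTensorIso g _ _).hom ≫
            (A.act g).map (λ_ (𝟙_ C)).hom) ▷ X := by
        rw [← whisker_exchange_assoc, MonoidalCategory.tensorHom_def']; simp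
      _ = _ := by rw [h₂]; monoidal
  have h₄ : (ρ_ X).hom = a.hom := by
    rw [← cancel_epi (ρ_ _).hom, ← rightUnitor_naturality, ← rightUnitor_naturality, h₃]
  rw [hb, h₄]

/-- The `G`-braiding of the unit is canonical, again because of `1 ⊗ 1 ≅ 1`. -/
theorem GBraided.braiding_unit_left (h : P 1 (𝟙_ C)) (Y : C) :
    (B.braiding h Y).hom = (λ_ Y).hom ≫ (ρ_ Y).inv ≫ (A.oneIso Y).inv ▷ 𝟙_ C := by
  obtain ⟨a, hb⟩ : ∃ a : ∀ Y : C, 𝟙_ C ⊗ Y ≅ Y, ∀ Y : C,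
      (B.braiding h Y).hom = (a Y).hom ≫ (ρ_ Y).inv ≫ (A.oneIso Y).inv ▷ 𝟙_ C :=
    ⟨fun Y => B.braiding h Y ≪≫ whiskerRightIso (A.oneIso Y) (𝟙_ C) ≪≫ ρ_ Y, by simp⟩
  have ha {Y Z : C} (f : Y ⟶ Z) : 𝟙_ C ◁ f ≫ (a Z).hom = (a Y).hom ≫ f := by
    have h₁ (Y : C) : (a Y).hom = (B.braiding h Y).hom ≫ (A.oneIso Y).hom ▷ 𝟙_ C ≫ (ρ_ Y).hom := by
      simp [hb]
    rw [h₁, h₁, reassoc_of% B.braiding_naturality_right, ← comp_whiskerRight_assoc,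
      A.oneIso_naturality]
    simp
  have h₀ : P 1 (𝟙_ C ⊗ 𝟙_ C) := by simpa using B.grading.tensor h h
  have h₁ := B.braiding_naturality_left h₀ h (λ_ (𝟙_ C)).hom Y
  have h₂ : 𝟙_ C ◁ (λ_ Y).hom = 𝟙_ C ◁ (a Y).hom := by
    rw [← cancel_epi (α_ _ _ _).hom, ← cancel_mono ((a Y).hom ≫ (ρ_ Y).inv ≫
      (A.oneIso Y).inv ▷ 𝟙_ C)]
    calc
      _ = (λ_ (𝟙_ C)).hom ▷ Y ≫ (B.braiding h Y).hom := by rw [hb, unitors_equal]; monoidal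
      _ = (α_ _ _ _).hom ≫ 𝟙_ C ◁ ((a Y).hom ≫ (ρ_ Y).inv ≫ (A.oneIso Y).inv ▷ 𝟙_ C) ≫
          (α_ _ _ _).inv ≫ ((a _).hom ≫ (ρ_ _).inv) ▷ 𝟙_ C ≫ (α_ _ _ _).hom ≫
          (A.act 1).obj Y ◁ (λ_ (𝟙_ C)).hom := by
        rw [h₁, B.braiding_tensor_left' (mul_one 1) h h, A.mulIso_one_left, hb Y, hb]; simp
      _ = (α_ _ _ _).hom ≫ 𝟙_ C ◁ ((a Y).hom ≫ (ρ_ Y).inv) ≫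
          (α_ _ _ _).inv ≫ (𝟙_ C ◁ (A.oneIso Y).inv ≫ (a _).hom ≫ (ρ_ _).inv) ▷ 𝟙_ C ≫
            (α_ _ _ _).hom ≫ (A.act 1).obj Y ◁ (λ_ (𝟙_ C)).hom := by
        simp
      _ = _ := by
        rw [reassoc_of% ha]
        simp
  have h₃ : (λ_ Y).hom = (a Y).hom := by
    rw [← cancel_epi (λ_ _).hom, ← leftUnitor_naturality, ← leftUnitor_naturality, h₂]
  rw [hb, h₃]

/-- The `G`-braiding with an object of the form `^h Y`, where `g h = e`. -/
def GBraided.unbraiding {g h : G} (e : g * h = 1) {X : C} (hX : P g X) (Y : C) :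
    X ⊗ (A.act h).obj Y ≅ Y ⊗ X :=
  B.braiding hX ((A.act h).obj Y) ≪≫ whiskerRightIso (A.cancelIso e Y) X

theorem GBraided.unbraiding_hom {g h : G} (e : g * h = 1) {X : C} (hX : P g X) (Y : C) :
    (B.unbraiding e hX Y).hom =
      (B.braiding hX ((A.act h).obj Y)).hom ≫ (A.cancelIso e Y).hom ▷ X := rfl

section

variable {g h : G} (e : g * h = 1)

theorem GBraided.unbraiding_naturality_right {X : C} (hX : P g X) {Y Y' : C} (f : Y ⟶ Y') :
    X ◁ (A.act h).map f ≫ (B.unbraiding e hX Y').hom = (B.unbraiding e hX Y).hom ≫ f ▷ X := by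
  simp only [unbraiding_hom, reassoc_of% braiding_naturality_right, Category.assoc,
    ← comp_whiskerRight, GAction.cancelIso_naturality]

theorem GBraided.unbraiding_naturality_left {X X' : C} (hX : P g X) (hX' : P g X')
    (f : X ⟶ X') (Y : C) :
    f ▷ (A.act h).obj Y ≫ (B.unbraiding e hX' Y).hom = (B.unbraiding e hX Y).hom ≫ Y ◁ f := by
  simp only [unbraiding_hom, reassoc_of% B.braiding_naturality_left hX hX', Category.assoc,
    whisker_exchange]

theorem GBraided.unbraiding_unit {X : C} (hX : P g X) :
    X ◁ (B.actUnitIso h).hom ≫ (B.unbraiding e hX (𝟙_ C)).hom = (ρ_ X).hom ≫ (λ_ X).inv := by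
  rw [unbraiding_hom, reassoc_of% braiding_naturality_right, braiding_unit_right]
  simp only [Category.assoc, ← comp_whiskerRight, B.cancelIso_unit]
  simp

theorem GBraided.unbraiding_tensor_right {X : C} (hX : P g X) (Y₁ Y₂ : C) :
    X ◁ (B.actTensorIso h Y₁ Y₂).hom ≫ (B.unbraiding e hX (Y₁ ⊗ Y₂)).hom =
      (α_ _ _ _).inv ≫ (B.unbraiding e hX Y₁).hom ▷ (A.act h).obj Y₂ ≫ (α_ _ _ _).hom ≫
        Y₁ ◁ (B.unbraiding e hX Y₂).hom ≫ (α_ _ _ _).inv := by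
  rw [unbraiding_hom, reassoc_of% braiding_naturality_right, braiding_tensor_right']
  simp only [Category.assoc, ← comp_whiskerRight, B.cancelIso_tensor]
  rw [MonoidalCategory.tensorHom_def]
  simp only [unbraiding_hom, comp_whiskerRight, whiskerLeft_comp, Category.assoc,
    associator_inv_naturality_middle, associator_naturality_left_assoc]
  rw [← whisker_exchange_assoc, associator_inv_naturality_left_assoc]

end

theorem GBraided.unbraiding_tensor_left {g₁ g₂ g h₁ h₂ h : G} (e₁ : g₁ * h₁ = 1)
    (e₂ : g₂ * h₂ = 1) (e : g * h = 1) (eg : g₁ * g₂ = g) (eh : h₂ * h₁ = h) {X₁ X₂ : C}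
    (hX₁ : P g₁ X₁) (hX₂ : P g₂ X₂) (hX : P g (X₁ ⊗ X₂)) (Y : C) :
    (X₁ ⊗ X₂) ◁ (A.mulIso eh Y).hom ≫ (B.unbraiding e hX Y).hom =
      (α_ _ _ _).hom ≫ X₁ ◁ (B.unbraiding e₂ hX₂ ((A.act h₁).obj Y)).hom ≫ (α_ _ _ _).inv ≫
        (B.unbraiding e₁ hX₁ Y).hom ▷ X₂ ≫ (α_ _ _ _).hom := by
  have h₃ : (A.mulIso eg ((A.act h₂).obj ((A.act h₁).obj Y))).hom ≫
      (A.act g).map (A.mulIso eh Y).hom ≫ (A.cancelIso e Y).hom =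
        (A.act g₁).map (A.cancelIso e₂ ((A.act h₁).obj Y)).hom ≫ (A.cancelIso e₁ Y).hom := by
    have e₃ : g * h₂ = g₁ := by rw [← eg, mul_assoc, e₂, mul_one]
    rw [A.map_mulIso_cancelIso eh e e₃ e₁, reassoc_of% A.mulIso_mulIso e₂ eg e₃]
  rw [unbraiding_hom, reassoc_of% braiding_naturality_right, B.braiding_tensor_left' eg hX₁ hX₂]
  simp only [unbraiding_hom, comp_whiskerRight, whiskerLeft_comp, Category.assoc,
    associator_inv_naturality_middle_assoc]
  rw [← comp_whiskerRight_assoc (X₁ ◁ _), B.braiding_naturality_right hX₁]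
  simp only [← associator_naturality_left, ← comp_whiskerRight_assoc, Category.assoc,
    ← comp_whiskerRight, h₃]

/-- The `G`-braidings with the `^h Y`, where `g h = e`, are compatible with the action. -/
theorem GBraided.unbraiding_act {a g h g' h' m : G} (e : g * h = 1) (e' : g' * h' = 1)
    (eh : a * h = m) (eh' : h' * a = m) {X : C} (hX : P g X) (hX' : P g' ((A.act a).obj X))
    (Y : C) :
    (A.act a).obj X ◁ (A.mulIso eh Y).hom ≫ (A.act a).obj X ◁ (A.mulIso eh' Y).inv ≫
        (B.unbraiding e' hX' ((A.act a).obj Y)).hom ≫ (B.actTensorIso a Y X).hom =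
      (B.actTensorIso a X ((A.act h).obj Y)).hom ≫ (A.act a).map (B.unbraiding e hX Y).hom := by
  have hg : g' * a = a * g := by
    rw [eq_inv_of_mul_eq_one_left e', eq_inv_of_mul_eq_one_left e, inv_mul_eq_iff_eq_mul,
      ← mul_assoc, eq_mul_inv_iff_mul_eq, eh, eh']
  have en : a * g * h = a := by rw [mul_assoc, e, mul_one]
  have en' : g' * m = a := by rw [← eh', ← mul_assoc, e', one_mul]
  have h₁ := B.braiding_act' hX hX' rfl hg ((A.act h).obj Y)
  have h₂ : (A.mulIso hg ((A.act h).obj Y)).hom ≫ (A.mulIso rfl ((A.act h).obj Y)).inv ≫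
      (A.act a).map (A.cancelIso e Y).hom = (A.act g').map (A.mulIso eh Y).hom ≫
        (A.act g').map (A.mulIso eh' Y).inv ≫ (A.cancelIso e' ((A.act a).obj Y)).hom := by
    rw [← A.map_mulIso_mulIso e' eh' en', ← A.mulIso_mulIso e rfl en,
      ← Functor.map_comp_assoc _ (A.mulIso eh' Y).inv]
    simp [A.mulIso_assoc eh en' hg en]
  rw [← cancel_mono (B.actTensorIso a Y X).inv]
  have h₃ := congrArg (fun f => f ≫ ((A.mulIso rfl ((A.act h).obj Y)).inv ≫
      (A.act a).map (A.cancelIso e Y).hom) ▷ (A.act a).obj X) h₁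
  simp only [Category.assoc, ← comp_whiskerRight, Iso.hom_inv_id_assoc, h₂] at h₃
  rw [unbraiding_hom, unbraiding_hom]
  simp only [comp_whiskerRight] at h₃
  simp only [Category.assoc, Iso.hom_inv_id, Category.comp_id,
    Functor.map_comp, B.actTensorIso_inv_naturality_left, reassoc_of% B.braiding_naturality_right,
    h₃]

end Braided

/-! ### Duals for the opposite product -/

section ReversePairings

variable {k : Type w} {G : Type t} {C : Type u} [Field k] [Group G] [Category.{v} C] [Abelian C]
  [Linear k C] [MultitensorCategory k C] {A : GAction k G C} {P : G → ObjectProperty C}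
  (B : GBraided A P)

/-- The image of a pairing under the action. -/
def GBraided.actEv (g : G) {X Y : C} (f : X ⊗ Y ⟶ 𝟙_ C) :
    (A.act g).obj X ⊗ (A.act g).obj Y ⟶ 𝟙_ C :=
  (B.actTensorIso g X Y).hom ≫ (A.act g).map f ≫ (B.actUnitIso g).inv

/-- The image of a copairing under the action. -/
def GBraided.actCoev (g : G) {X Y : C} (f : 𝟙_ C ⟶ X ⊗ Y) :
    𝟙_ C ⟶ (A.act g).obj X ⊗ (A.act g).obj Y :=
  (B.actUnitIso g).hom ≫ (A.act g).map f ≫ (B.actTensorIso g X Y).inv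

/-- The image of a dual pair under the action. -/
@[reducible]
def GBraided.actPairing (g : G) {X Y : C} (p : ExactPairing X Y) :
    ExactPairing ((A.act g).obj X) ((A.act g).obj Y) :=
  letI := B.monoidal g
  mapExactPairing (A.act g) p

theorem GBraided.actPairing_evaluation (g : G) {X Y : C} (p : ExactPairing X Y) :
    (B.actPairing g p).evaluation _ _ = B.actEv g (p.evaluation X Y) := rfl

theorem GBraided.actPairing_coevaluation (g : G) {X Y : C} (p : ExactPairing X Y) :
    (B.actPairing g p).coevaluation _ _ = B.actCoev g (p.coevaluation X Y) := rfl

/-- A pairing `X₁ ⊗ X₂ ⟶ 1` of objects of inverse degrees can be pulled across a strand. -/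
theorem GBraided.ev_pull_left {g₁ g₂ : G} (e : g₁ * g₂ = 1) {X₁ X₂ : C} (h₁ : P g₁ X₁)
    (h₂ : P g₂ X₂) (f : X₁ ⊗ X₂ ⟶ 𝟙_ C) (Y : C) :
    X₁ ◁ (B.braiding h₂ Y).hom ≫ (α_ _ _ _).inv ≫ (B.unbraiding e h₁ Y).hom ▷ X₂ ≫
      (α_ _ _ _).hom ≫ Y ◁ f = (α_ _ _ _).inv ≫ f ▷ Y ≫ (λ_ Y).hom ≫ (ρ_ Y).inv := by
  have h : P 1 (X₁ ⊗ X₂) := e ▸ B.grading.tensor h₁ h₂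
  have h₃ := B.braiding_naturality_left h B.grading.unit_mem f Y
  rw [B.braiding_unit_left, B.braiding_tensor_left' e h₁ h₂] at h₃
  have h₄ := congrArg (fun t => (α_ _ _ _).inv ≫ t ≫ (A.oneIso Y).hom ▷ 𝟙_ C) h₃
  simp only [Category.assoc, ← comp_whiskerRight, Iso.inv_hom_id, id_whiskerRight,
    Category.comp_id, whisker_exchange, Iso.inv_hom_id_assoc] at h₄
  rw [h₄, unbraiding_hom, GAction.cancelIso_hom]
  simp

theorem GBraided.coev_pull_left {g₁ g₂ : G} (e : g₁ * g₂ = 1) {X₁ X₂ : C} (h₁ : P g₁ X₁)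
    (h₂ : P g₂ X₂) (f : 𝟙_ C ⟶ X₁ ⊗ X₂) (Y : C) :
    f ▷ Y ≫ (α_ _ _ _).hom ≫ X₁ ◁ (B.braiding h₂ Y).hom ≫ (α_ _ _ _).inv ≫
      (B.unbraiding e h₁ Y).hom ▷ X₂ ≫ (α_ _ _ _).hom = (λ_ Y).hom ≫ (ρ_ Y).inv ≫ Y ◁ f := by
  have h : P 1 (X₁ ⊗ X₂) := e ▸ B.grading.tensor h₁ h₂
  have h₃ := B.braiding_naturality_left B.grading.unit_mem h f Y
  rw [B.braiding_unit_left, B.braiding_tensor_left' e h₁ h₂] at h₃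
  have h₄ := congrArg (fun t => t ≫ (A.oneIso Y).hom ▷ (X₁ ⊗ X₂)) h₃
  simp only [Category.assoc, whisker_exchange] at h₄
  rw [inv_hom_whiskerRight_assoc] at h₄
  rw [← h₄, unbraiding_hom, GAction.cancelIso_hom]
  simp

theorem GBraided.ev_pull_right {g : G} {X Y₁ Y₂ : C} (hX : P g X) (f : Y₁ ⊗ Y₂ ⟶ 𝟙_ C) :
    (B.braiding hX Y₁).hom ▷ Y₂ ≫ (α_ _ _ _).hom ≫ (A.act g).obj Y₁ ◁ (B.braiding hX Y₂).hom ≫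
      (α_ _ _ _).inv ≫ B.actEv g f ▷ X = (α_ _ _ _).hom ≫ X ◁ f ≫ (ρ_ X).hom ≫ (λ_ X).inv := by
  have h₃ := B.braiding_naturality_right hX f
  rw [B.braiding_unit_right, B.braiding_tensor_right'] at h₃
  have h₄ := congrArg (fun t => (α_ _ _ _).hom ≫ t ≫ (B.actUnitIso g).inv ▷ X) h₃
  simp only [Category.assoc, ← comp_whiskerRight, Iso.hom_inv_id, id_whiskerRight,
    Category.comp_id] at h₄
  rw [h₄]
  simp [actEv]

theorem GBraided.unbraiding_coev_right {g h : G} (e : g * h = 1) {X Y₁ Y₂ : C} (hX : P g X)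
    (f : 𝟙_ C ⟶ Y₁ ⊗ Y₂) :
    X ◁ B.actCoev h f ≫ (α_ _ _ _).inv ≫ (B.unbraiding e hX Y₁).hom ▷ (A.act h).obj Y₂ ≫
      (α_ _ _ _).hom ≫ Y₁ ◁ (B.unbraiding e hX Y₂).hom ≫ (α_ _ _ _).inv =
        (ρ_ X).hom ≫ (λ_ X).inv ≫ f ▷ X := by
  have h₃ := B.unbraiding_naturality_right e hX f
  rw [← B.unbraiding_tensor_right, actCoev]
  simp only [whiskerLeft_comp, Category.assoc, whiskerLeft_inv_hom_assoc, h₃]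
  rw [← Category.assoc, B.unbraiding_unit, Category.assoc]

/-- For `X' ∈ C_{h'}` the braiding of `^{h'} X'` with `X` is the image under the action of the
braiding of `X'` with `^h X`, where `h' h = e`. -/
theorem GBraided.act_unbraiding {h h' : G} (e : h * h' = 1) (e' : h' * h = 1) {X' : C}
    (hX' : P h' X') (hD : P h' ((A.act h').obj X')) (X : C) :
    (A.act h').obj X' ◁ (A.cancelIso e' X).hom ≫ (B.braiding hD X).hom ≫
        (B.actTensorIso h' X X').hom =
      (B.actTensorIso h' X' ((A.act h).obj X)).hom ≫
        (A.act h').map (B.unbraiding e' hX' X).hom := by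
  rw [← B.unbraiding_act e' e' e' e hX' hD, unbraiding_hom, ← A.map_cancelIso e' e]
  rw [Category.assoc, ← reassoc_of% B.braiding_naturality_right]
  simp only [← whiskerLeft_comp_assoc]
  simp [GAction.cancelIso_hom]

theorem GBraided.actEv_unbraiding {h h' : G} (e : h * h' = 1) {X X' : C} (hX : P h X)
    (hE : P h ((A.act h').obj X)) (f : X' ⊗ X ⟶ 𝟙_ C) :
    B.actEv h' ((B.unbraiding e hX X').hom ≫ f) =
      (B.unbraiding e hE ((A.act h').obj X')).hom ≫ B.actEv h' f := by
  have := B.unbraiding_act (a := h') e e rfl rfl hX hE X'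
  simp only [whiskerLeft_hom_inv_assoc] at this
  simp only [actEv, Functor.map_comp, Category.assoc, reassoc_of% this]

theorem GBraided.reverseDual_zigzag_left {h h' : G} (e : h * h' = 1) {X X' : C} (hX : P h X)
    (hD : P h' ((A.act h').obj X')) (r : ExactPairing X X') :
    X ◁ (B.actCoev h' (r.coevaluation X X') ≫ (B.braiding hD X).inv) ≫ (α_ _ _ _).inv ≫
      ((B.unbraiding e hX X').hom ≫ r.evaluation X X') ▷ X = (ρ_ X).hom ≫ (λ_ X).inv := by
  have e' : h' * h = 1 := mul_eq_one_comm.1 e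
  have hX' : P h' X' := by
    rw [eq_inv_of_mul_eq_one_right e]; exact B.grading.dual_mem r hX
  -- The coevaluation is the image under the action of `κ`.
  let κ : 𝟙_ C ⟶ X' ⊗ (A.act h).obj X := r.coevaluation X X' ≫ (B.unbraiding e' hX' X).inv
  have hκ : B.actCoev h' (r.coevaluation X X') ≫ (B.braiding hD X).inv =
      B.actCoev h' κ ≫ (A.act h').obj X' ◁ (A.cancelIso e' X).hom := by
    rw [Iso.comp_inv_eq, ← cancel_mono (B.actTensorIso h' X X').hom, Category.assoc,
      Category.assoc, B.act_unbraiding e e' hX' hD]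
    simp [actCoev, κ, ← Functor.map_comp]
  have h₁ : (B.unbraiding e hX ((A.act h).obj X)).inv ≫ X ◁ (A.cancelIso e' X).hom =
      (B.braiding hX X).inv := by
    rw [Iso.inv_comp_eq, Iso.eq_comp_inv, B.braiding_naturality_right, A.map_cancelIso e e',
      unbraiding_hom]
  have h₂ := B.unbraiding_coev_right e hX κ
  have h₃ := B.ev_pull_left e' hX' hX (r.evaluation X X') X
  have h₄ : (α_ _ _ _).inv ≫ (B.unbraiding e' hX' X).inv ▷ X ≫ (α_ _ _ _).hom ≫
      X' ◁ (B.braiding hX X).inv ≫ (α_ _ _ _).inv ≫ r.evaluation X X' ▷ X =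
        X ◁ r.evaluation X X' ≫ (ρ_ X).hom ≫ (λ_ X).inv := by
    have h₅ := congrArg (fun t => t ≫ (ρ_ X).hom ≫ (λ_ X).inv) h₃
    simp only [Category.assoc, Iso.inv_hom_id_assoc, Iso.hom_inv_id, Category.comp_id] at h₅
    rw [← h₅]
    simp
  rw [hκ]
  calc
    _ = (X ◁ B.actCoev h' κ ≫ (α_ _ _ _).inv ≫
      (B.unbraiding e hX X').hom ▷ (A.act h').obj ((A.act h).obj X) ≫
      (α_ _ _ _).hom ≫ X' ◁ (B.unbraiding e hX ((A.act h).obj X)).hom ≫ (α_ _ _ _).inv) ≫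
      (α_ _ _ _).hom ≫ X' ◁ ((B.unbraiding e hX ((A.act h).obj X)).inv ≫
        X ◁ (A.cancelIso e' X).hom) ≫ (α_ _ _ _).inv ≫ r.evaluation X X' ▷ X := by
      simp only [whiskerLeft_comp, comp_whiskerRight, Category.assoc,
        associator_inv_naturality_right_assoc, whisker_exchange_assoc]
      simp
    _ = (ρ_ X).hom ≫ (λ_ X).inv ≫ r.coevaluation X X' ▷ X ≫ (α_ _ _ _).hom ≫ (α_ _ _ _).inv ≫
      (B.unbraiding e' hX' X).inv ▷ X ≫ (α_ _ _ _).hom ≫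
      X' ◁ (B.braiding hX X).inv ≫ (α_ _ _ _).inv ≫ r.evaluation X X' ▷ X := by
      rw [h₁, h₂]; simp [κ]
    _ = _ := by
      rw [h₄, ExactPairing.evaluation_coevaluation_assoc]; simp

theorem GBraided.reverseDual_zigzag_right {h h' : G} (e : h * h' = 1) {X X' : C} (hX : P h X)
    (hD : P h' ((A.act h').obj X')) (r : ExactPairing X X') :
    (B.actCoev h' (r.coevaluation X X') ≫ (B.braiding hD X).inv) ▷ (A.act h').obj X' ≫
      (α_ _ _ _).hom ≫ (A.act h').obj X' ◁ ((B.unbraiding e hX X').hom ≫ r.evaluation X X') =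
        (λ_ _).hom ≫ (ρ_ _).inv := by
  have hE : P h ((A.act h').obj X) := by
    have := B.act_mem h' hX
    rwa [mul_eq_one_comm.1 e, one_mul, inv_eq_of_mul_eq_one_left e] at this
  let D := (A.act h').obj X'
  have h₁ := B.actEv_unbraiding e hX hE (r.evaluation X X')
  have h₂ := B.ev_pull_right hD ((B.unbraiding e hX X').hom ≫ r.evaluation X X')
  have h₃ := B.coev_pull_left e hE hD (B.actCoev h' (r.coevaluation X X')) ((A.act h').obj X')
  have h₄ := (B.actPairing h' r).coevaluation_evaluation
  rw [actPairing_evaluation, actPairing_coevaluation] at h₄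
  calc
    _ = B.actCoev h' (r.coevaluation X X') ▷ D ≫ (B.braiding hD X).inv ▷ D ≫
        ((α_ _ _ _).hom ≫ D ◁ ((B.unbraiding e hX X').hom ≫ r.evaluation X X') ≫
          (ρ_ D).hom ≫ (λ_ D).inv) ≫ (λ_ D).hom ≫ (ρ_ D).inv := by
      simp [D]
    _ = (B.actCoev h' (r.coevaluation X X') ▷ D ≫ (α_ _ _ _).hom ≫
        (A.act h').obj X ◁ (B.braiding hD D).hom ≫ (α_ _ _ _).inv ≫
        (B.unbraiding e hE D).hom ▷ D ≫ (α_ _ _ _).hom) ≫ (α_ _ _ _).inv ≫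
          B.actEv h' (r.evaluation X X') ▷ D ≫ (λ_ D).hom ≫ (ρ_ D).inv := by
      rw [← h₂, h₁]; simp [D]
    _ = _ := by
      rw [h₃]
      simp only [Category.assoc]
      rw [reassoc_of% h₄]
      simp

/-- The dual `^{h⁻¹} X'` for the opposite product of an object `X ∈ C_h` with dual `X'`. -/
@[reducible]
def GBraided.reverseDual {h h' : G} (e : h * h' = 1) {X X' : C} (hX : P h X)
    (hD : P h' ((A.act h').obj X')) (r : ExactPairing X X') :
    ExactPairing ((A.act h').obj X') X where
  coevaluation' := B.actCoev h' (r.coevaluation X X') ≫ (B.braiding hD X).inv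
  evaluation' := (B.unbraiding e hX X').hom ≫ r.evaluation X X'
  coevaluation_evaluation' := B.reverseDual_zigzag_left e hX hD r
  evaluation_coevaluation' := B.reverseDual_zigzag_right e hX hD r

end ReversePairings

/-! ### Pairings for the opposite product -/

section ReversePairings

variable {k : Type w} {G : Type t} {C : Type u} [Field k] [Group G] [Category.{v} C] [Abelian C]
  [Linear k C] [MultitensorCategory k C] {A : GAction k G C} {P : G → ObjectProperty C}
  (B : GBraided A P)

theorem GBraided.act_mem' (B : GBraided A P) {a g g' : G} (e : g' * a = a * g) {X : C}
    (hX : P g X) : P g' ((A.act a).obj X) := by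
  rw [eq_mul_inv_of_mul_eq e]
  exact B.act_mem a hX

theorem GBraided.dual_mem' (B : GBraided A P) {h h' : G} (e : h * h' = 1) {X X' : C} (hX : P h X)
    (r : ExactPairing X X') : P h' X' := by
  rw [eq_inv_of_mul_eq_one_right e]
  exact B.grading.dual_mem r hX

theorem GBraided.actDual_mem (B : GBraided A P) {h h' : G} (e : h * h' = 1) {X X' : C} (hX : P h X)
    (r : ExactPairing X X') : P h' ((A.act h').obj X') :=
  B.act_mem' rfl (B.dual_mem' e hX r)

theorem GBraided.map_whiskerRight_actEv (g : G) {X X₂ Y : C} (f : X ⟶ X₂) (φ : X₂ ⊗ Y ⟶ 𝟙_ C) :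
    (A.act g).map f ▷ (A.act g).obj Y ≫ B.actEv g φ = B.actEv g (f ▷ Y ≫ φ) := by
  simp [actEv, reassoc_of% B.actTensorIso_naturality_left]

theorem GBraided.whiskerLeft_map_actEv (g : G) {X Y Y₂ : C} (f : Y ⟶ Y₂) (φ : X ⊗ Y₂ ⟶ 𝟙_ C) :
    (A.act g).obj X ◁ (A.act g).map f ≫ B.actEv g φ = B.actEv g (X ◁ f ≫ φ) := by
  simp [actEv, reassoc_of% B.actTensorIso_naturality_right]

theorem GBraided.actEv_actEv {g h l : G} (e : g * h = l) {X Y : C} (φ : X ⊗ Y ⟶ 𝟙_ C) :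
    B.actEv g (B.actEv h φ) =
      ((A.mulIso e X).hom ⊗ₘ (A.mulIso e Y).hom) ≫ B.actEv l φ := by
  have h₁ : (A.act g).map (B.actUnitIso h).inv ≫ (B.actUnitIso g).inv =
      (A.mulIso e (𝟙_ C)).hom ≫ (B.actUnitIso l).inv := by
    rw [Iso.eq_comp_inv, ← B.mulIso_unit e]
    simp [← Functor.map_comp_assoc]
  simp only [actEv, Functor.map_comp, Category.assoc, h₁]
  rw [reassoc_of% A.mulIso_naturality, reassoc_of% B.mulIso_tensor]

/-- Rebracketing under the image of a pairing by the action. -/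
theorem GBraided.actTensorIso_actEv (g : G) {X Y Z : C} (φ : X ⊗ (Y ⊗ Z) ⟶ 𝟙_ C) :
    (A.act g).obj X ◁ (B.actTensorIso g Y Z).hom ≫ B.actEv g φ =
      (α_ _ _ _).inv ≫ (B.actTensorIso g X Y).hom ▷ (A.act g).obj Z ≫
        B.actEv g ((α_ X Y Z).hom ≫ φ) := by
  simp only [actEv, Functor.map_comp, Category.assoc, reassoc_of% B.actTensorIso_assoc,
    Iso.inv_hom_id_assoc]

/-- A pairing `Z ⊗ X' ⟶ 1` transported to a pairing of `^a X'` with `Z`, where `^a X' ∈ C_a`. -/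
def GBraided.reverseEv {a : G} {X' Z : C} (hD : P a ((A.act a).obj X')) (φ : Z ⊗ X' ⟶ 𝟙_ C) :
    (A.act a).obj X' ⊗ Z ⟶ 𝟙_ C :=
  (B.braiding hD Z).hom ≫ B.actEv a φ

theorem GBraided.whiskerLeft_reverseEv {a : G} {X' Z Z₂ : C} (hD : P a ((A.act a).obj X'))
    (f : Z ⟶ Z₂) (φ : Z₂ ⊗ X' ⟶ 𝟙_ C) :
    (A.act a).obj X' ◁ f ≫ B.reverseEv hD φ = B.reverseEv hD (f ▷ X' ≫ φ) := by
  simp only [reverseEv, reassoc_of% B.braiding_naturality_right, B.map_whiskerRight_actEv]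

theorem GBraided.map_whiskerRight_reverseEv {a : G} {X' X₂' Z : C} (hD : P a ((A.act a).obj X'))
    (hD₂ : P a ((A.act a).obj X₂')) (f : X' ⟶ X₂') (φ : Z ⊗ X₂' ⟶ 𝟙_ C) :
    (A.act a).map f ▷ Z ≫ B.reverseEv hD₂ φ = B.reverseEv hD (Z ◁ f ≫ φ) := by
  simp only [reverseEv, reassoc_of% B.braiding_naturality_left hD hD₂, B.whiskerLeft_map_actEv]

/-- The hexagon of the `G`-braiding in terms of `GBraided.reverseEv`. -/
theorem GBraided.reverseEv_tensor {a : G} {X' Z V : C} (hD : P a ((A.act a).obj X'))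
    (φ : Z ⊗ (V ⊗ X') ⟶ 𝟙_ C) :
    (B.braiding hD Z).hom ▷ V ≫ (α_ _ _ _).hom ≫
        (A.act a).obj Z ◁ ((B.braiding hD V).hom ≫ (B.actTensorIso a V X').hom) ≫ B.actEv a φ =
      (α_ _ _ _).hom ≫ B.reverseEv hD ((α_ Z V X').hom ≫ φ) := by
  rw [reverseEv, B.braiding_tensor_right', whiskerLeft_comp_assoc, B.actTensorIso_actEv]
  simp

/-- The comparison between the two descriptions of the dual of `Y ⊗ X` for the opposite product:
the product of the duals `^{g'} X'` and `^{h'} Y'`, and the dual `^{g' h'} (X' ⊗ Y')`. -/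
def GBraided.reverseDualTensor {g' h' l' : G} (el : g' * h' = l') {X' Y' : C}
    (hDX : P g' ((A.act g').obj X')) (hDY : P h' ((A.act h').obj Y')) :
    (A.act g').obj X' ⊗ (A.act h').obj Y' ⟶ (A.act l').obj (X' ⊗ Y') :=
  (B.braiding hDX ((A.act h').obj Y')).hom ≫ (B.actTensorIso g' ((A.act h').obj Y') X').hom ≫
    (A.act g').map ((B.braiding hDY X').hom ≫ (B.actTensorIso h' X' Y').hom) ≫
      (A.mulIso el (X' ⊗ Y')).hom

/-- The comparison `GBraided.reverseDualTensor` respects evaluations: the two evaluations can be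
pulled, one after the other, across the strands that separate them. -/
theorem GBraided.reverseDualTensor_ev {g g' h h' l l' : G} (eg : g * g' = 1) (eh : h * h' = 1)
    (el : l * l' = 1) (em : h * g = l) (em' : g' * h' = l') {X X' Y Y' : C} (hX : P g X)
    (hY : P h Y) (hYX : P l (Y ⊗ X)) (hDX : P g' ((A.act g').obj X'))
    (hDY : P h' ((A.act h').obj Y')) (eX : X' ⊗ X ⟶ 𝟙_ C) (eY : Y' ⊗ Y ⟶ 𝟙_ C) :
    (Y ⊗ X) ◁ B.reverseDualTensor em' hDX hDY ≫ (B.unbraiding el hYX (X' ⊗ Y')).hom ≫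
        nestedPairing eX eY =
      nestedPairing ((B.unbraiding eh hY Y').hom ≫ eY) ((B.unbraiding eg hX X').hom ≫ eX) := by
  have h₁ := B.ev_pull_left eg hX hDX ((B.unbraiding eg hX X').hom ≫ eX) ((A.act h').obj Y')
  have h₂ := B.ev_pull_left eh hY hDY ((B.unbraiding eh hY Y').hom ≫ eY) X'
  have h₃ : Y ◁ ((B.braiding hDY X').hom ≫ (B.actTensorIso h' X' Y').hom) ≫
      (B.unbraiding eh hY (X' ⊗ Y')).hom ≫ (α_ _ _ _).hom ≫ X' ◁ eY =
        (α_ _ _ _).inv ≫ ((B.unbraiding eh hY Y').hom ≫ eY) ▷ X' ≫ (λ_ X').hom ≫ (ρ_ X').inv := by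
    rw [← h₂, whiskerLeft_comp_assoc, reassoc_of% B.unbraiding_tensor_right eh hY]
    simp
  have h₄ : nestedPairing eX eY = (α_ _ _ _).inv ≫ ((α_ _ _ _).hom ≫ X' ◁ eY) ▷ X ≫
      (ρ_ X').hom ▷ X ≫ eX := by
    simp only [nestedPairing]; monoidal
  let θ : (A.act h').obj Y' ⊗ X' ⟶ (A.act h').obj (X' ⊗ Y') :=
    (B.braiding hDY X').hom ≫ (B.actTensorIso h' X' Y').hom
  calc
    _ = (α_ _ _ _).hom ≫ Y ◁ (X ◁ (B.braiding hDX ((A.act h').obj Y')).hom ≫ (α_ _ _ _).inv ≫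
          (B.unbraiding eg hX ((A.act h').obj Y')).hom ▷ _ ≫ (α_ _ _ _).hom ≫
            (A.act h').obj Y' ◁ (B.unbraiding eg hX X').hom) ≫ Y ◁ (α_ _ _ _).inv ≫
          (α_ _ _ _).inv ≫ (Y ◁ θ ≫ (B.unbraiding eh hY (X' ⊗ Y')).hom) ▷ X ≫
            (α_ _ _ _).hom ≫ nestedPairing eX eY := by
      have h₅ := B.unbraiding_naturality_right eg hX θ
      have h₆ := B.unbraiding_tensor_right eg hX ((A.act h').obj Y') X'
      have h₇ := B.unbraiding_tensor_left eh eg el em em' hY hX hYX (X' ⊗ Y')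
      have h₈ : X ◁ (B.actTensorIso g' _ _).hom ≫ X ◁ (A.act g').map θ ≫
          (B.unbraiding eg hX ((A.act h').obj (X' ⊗ Y'))).hom = (α_ _ _ _).inv ≫
            (B.unbraiding eg hX ((A.act h').obj Y')).hom ▷ _ ≫ (α_ _ _ _).hom ≫
              (A.act h').obj Y' ◁ (B.unbraiding eg hX X').hom ≫ (α_ _ _ _).inv ≫ θ ▷ X := by
        rw [h₅, reassoc_of% h₆]
      rw [reverseDualTensor, whiskerLeft_comp_assoc, whiskerLeft_comp_assoc,
        whiskerLeft_comp_assoc, reassoc_of% h₇]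
      simp only [associator_naturality_right_assoc]
      rw [← whiskerLeft_comp_assoc Y, ← whiskerLeft_comp_assoc Y, ← whiskerLeft_comp_assoc Y,
        Category.assoc, Category.assoc, h₈]
      simp
    _ = (α_ _ _ _).hom ≫ Y ◁ (X ◁ (B.braiding hDX ((A.act h').obj Y')).hom ≫ (α_ _ _ _).inv ≫
          (B.unbraiding eg hX ((A.act h').obj Y')).hom ▷ _ ≫ (α_ _ _ _).hom ≫
            (A.act h').obj Y' ◁ ((B.unbraiding eg hX X').hom ≫ eX)) ≫ (α_ _ _ _).inv ≫
          ((B.unbraiding eh hY Y').hom ≫ eY) ▷ 𝟙_ C ≫ (ρ_ _).hom := by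
      have h₅ : (α_ _ _ _).inv ≫ (Y ◁ θ ≫ (B.unbraiding eh hY (X' ⊗ Y')).hom) ▷ X ≫
          (α_ _ _ _).hom ≫ nestedPairing eX eY = (α_ _ _ _).inv ≫ ((α_ _ _ _).inv ≫
            ((B.unbraiding eh hY Y').hom ≫ eY) ▷ X' ≫ (λ_ X').hom) ▷ X ≫ eX := by
        rw [h₄, Iso.hom_inv_id_assoc, ← comp_whiskerRight_assoc, Category.assoc, h₃]
        simp
      have h₆ : Y ◁ (α_ _ _ _).inv ≫ (α_ _ _ _).inv ≫ ((α_ _ _ _).inv ≫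
            ((B.unbraiding eh hY Y').hom ≫ eY) ▷ X' ≫ (λ_ X').hom) ▷ X ≫ eX =
          Y ◁ (A.act h').obj Y' ◁ eX ≫ (α_ _ _ _).inv ≫
            ((B.unbraiding eh hY Y').hom ≫ eY) ▷ 𝟙_ C ≫ (ρ_ _).hom := by
        calc
          _ = (α_ _ _ _).inv ≫ (((B.unbraiding eh hY Y').hom ≫ eY) ▷ (X' ⊗ X) ≫ 𝟙_ C ◁ eX) ≫
              (λ_ _).hom := by monoidal
          _ = _ := by rw [← whisker_exchange, unitors_equal]; monoidal
      rw [h₅, h₆]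
      simp only [whiskerLeft_comp, Category.assoc]
    _ = _ := by
      rw [h₁]
      calc
        _ = (α_ _ _ _).hom ≫ Y ◁ ((α_ _ _ _).inv ≫
            ((B.unbraiding eg hX X').hom ≫ eX) ▷ (A.act h').obj Y' ≫ (λ_ _).hom) ≫
            ((ρ_ _).inv ≫ ((B.unbraiding eh hY Y').hom ≫ eY) ▷ 𝟙_ C ≫ (ρ_ _).hom) := by monoidal
        _ = _ := by rw [rightUnitor_naturality, Iso.inv_hom_id_assoc, nestedPairing]

/-- The comparison `GBraided.reverseDualTensor` turns the transport of a nested pairing into the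
nested pairing of the transports. -/
theorem GBraided.reverseDualTensor_reverseEv {g' h' l' : G}
    (em' : g' * h' = l') {X X' Y Y' : C} (hDX : P g' ((A.act g').obj X'))
    (hDY : P h' ((A.act h').obj Y')) (hD : P l' ((A.act l').obj (X' ⊗ Y')))
    (eX : X ⊗ X' ⟶ 𝟙_ C) (eY : Y ⊗ Y' ⟶ 𝟙_ C) :
    B.reverseDualTensor em' hDX hDY ▷ (Y ⊗ X) ≫ B.reverseEv hD (nestedPairing eY eX) =
      nestedPairing (B.reverseEv hDX eX) (B.reverseEv hDY eY) := by
  have hT : P l' ((A.act g').obj X' ⊗ (A.act h').obj Y') := em' ▸ B.grading.tensor hDX hDY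
  set n := nestedPairing eY eX with hn
  calc
    _ = (α_ _ _ _).hom ≫ (A.act g').obj X' ◁ (B.braiding hDY (Y ⊗ X)).hom ≫ (α_ _ _ _).inv ≫
        (B.braiding hDX ((A.act h').obj (Y ⊗ X))).hom ▷ (A.act h').obj Y' ≫ (α_ _ _ _).hom ≫
          (A.act g').obj ((A.act h').obj (Y ⊗ X)) ◁ ((B.braiding hDX ((A.act h').obj Y')).hom ≫
            (B.actTensorIso g' ((A.act h').obj Y') X').hom) ≫
          B.actEv g' ((A.act h').obj (Y ⊗ X) ◁ ((B.braiding hDY X').hom ≫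
            (B.actTensorIso h' X' Y').hom) ≫ B.actEv h' n) := by
      rw [← B.whiskerLeft_map_actEv, B.actEv_actEv em', reverseEv,
        reassoc_of% B.braiding_naturality_left hT hD, B.braiding_tensor_left' em' hDX hDY,
        reverseDualTensor, MonoidalCategory.tensorHom_def']
      simp only [whiskerLeft_comp, Category.assoc, associator_naturality_left_assoc,
        ← whisker_exchange_assoc]
    _ = (α_ _ _ _).hom ≫ B.reverseEv hDX ((α_ _ _ _).hom ≫ (A.act h').obj Y' ◁
        ((α_ Y X X').hom ≫ Y ◁ eX ≫ (ρ_ Y).hom) ≫ B.reverseEv hDY eY) := by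
      have h : (α_ (Y ⊗ X) X' Y').hom ≫ n =
          ((α_ Y X X').hom ≫ Y ◁ eX ≫ (ρ_ Y).hom) ▷ Y' ≫ eY := by
        simp only [hn, nestedPairing]; monoidal
      rw [B.reverseEv_tensor, Iso.inv_hom_id_assoc, B.whiskerLeft_reverseEv,
        B.reverseEv_tensor, h, B.whiskerLeft_reverseEv]
    _ = _ := by
      have h : (α_ _ _ _).hom ≫ (A.act h').obj Y' ◁ ((α_ Y X X').hom ≫ Y ◁ eX ≫ (ρ_ Y).hom) ≫
          B.reverseEv hDY eY =
            ((α_ _ _ _).inv ≫ B.reverseEv hDY eY ▷ X ≫ (λ_ X).hom) ▷ X' ≫ eX := by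
        calc
          _ = (α_ _ _ _).hom ≫ (A.act h').obj Y' ◁ (α_ Y X X').hom ≫ (α_ _ _ _).inv ≫
              ((_ ⊗ Y) ◁ eX ≫ B.reverseEv hDY eY ▷ 𝟙_ C) ≫ (ρ_ _).hom := by monoidal
          _ = _ := by rw [whisker_exchange]; monoidal
      rw [h, ← B.whiskerLeft_reverseEv, nestedPairing]

end ReversePairings

section ReversePairings

variable {k : Type w} {G : Type t} {C : Type u} [Field k] [Group G] [Category.{v} C] [Abelian C]
  [Linear k C] [MultitensorCategory k C] {A : GAction k G C} {P : G → ObjectProperty C}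
  (B : GBraided A P)

theorem GBraided.unbraiding_dinatural {h h' : G} (e : h * h' = 1) {X X' Y Y' : C} (hX : P h X)
    (hY : P h Y) (f : X ⟶ Y) (f' : Y' ⟶ X') (eX : X' ⊗ X ⟶ 𝟙_ C) (eY : Y' ⊗ Y ⟶ 𝟙_ C)
    (hf : f' ▷ X ≫ eX = Y' ◁ f ≫ eY) :
    X ◁ (A.act h').map f' ≫ (B.unbraiding e hX X').hom ≫ eX =
      f ▷ (A.act h').obj Y' ≫ (B.unbraiding e hY Y').hom ≫ eY := by
  rw [reassoc_of% B.unbraiding_naturality_right, hf,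
    reassoc_of% B.unbraiding_naturality_left e hX hY]

/-- The dual `X''` for the opposite product of the dual of an object `X ∈ C_h`. -/
@[reducible]
def GBraided.reverseDualDual {h h' : G} (e : h * h' = 1) {X' X'' : C} (hX' : P h' X')
    (hE : P h ((A.act h).obj X'')) (s : ExactPairing X' X'') :
    ExactPairing X'' ((A.act h').obj X') :=
  letI := B.actPairing h' (B.reverseDual (mul_eq_one_comm.1 e) hX' hE s)
  exactPairingCongrLeft (A.cancelIso (mul_eq_one_comm.1 e) X'').symm

theorem GBraided.reverseDualDual_evaluation {h h' : G} (e : h * h' = 1) {X' X'' : C}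
    (hX' : P h' X') (hD : P h' ((A.act h').obj X')) (hE : P h ((A.act h).obj X''))
    (s : ExactPairing X' X'') :
    (B.reverseDualDual e hX' hE s).evaluation _ _ =
      B.reverseEv hD (s.evaluation X' X'') := by
  have e' := mul_eq_one_comm.1 e
  have h := B.act_unbraiding e e' hX' hD X''
  change (A.act h').obj X' ◁ (A.cancelIso e' X'').inv ≫
    B.actEv h' ((B.unbraiding e' hX' X'').hom ≫ s.evaluation X' X'') = _
  simp only [reverseEv, actEv, Functor.map_comp, Category.assoc, ← reassoc_of% h]
  simp

theorem GBraided.reverseDualDual_coevaluation {h h' : G} (e : h * h' = 1) {X' X'' : C}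
    (hX' : P h' X') (hX'' : P h X'') (hE : P h ((A.act h).obj X''))
    (s : ExactPairing X' X'') :
    (B.reverseDualDual e hX' hE s).coevaluation _ _ ≫ (B.unbraiding e hX'' X').hom =
      s.coevaluation X' X'' := by
  have e' := mul_eq_one_comm.1 e
  change (B.actCoev h' (B.actCoev h (s.coevaluation X' X'') ≫ (B.braiding hE X').inv) ≫
    (A.cancelIso e' X'').hom ▷ (A.act h').obj X') ≫ _ = _
  -- By equivariance of the braiding, `h₂`, its image under the action cancels the inverse braiding
  -- in the coevaluation.
  have hF : P h ((A.act h').obj ((A.act h).obj X'')) := B.act_mem' (e.trans e'.symm) hE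
  have h₁ := B.braiding_act' hE hF e' e X'
  have h₂ : (B.actTensorIso h' ((A.act h).obj X'') X').hom ≫
      (A.act h').map (B.braiding hE X').hom ≫ (B.actTensorIso h' _ _).inv ≫
        (A.cancelIso e' X').hom ▷ _ = (B.unbraiding e hF X').hom := by
    rw [unbraiding_hom, A.cancelIso_hom e, comp_whiskerRight, ← reassoc_of% h₁, A.cancelIso_hom,
      comp_whiskerRight]
  have h₃ : (B.actTensorIso h' ((A.act h).obj X') ((A.act h).obj X'')).inv ≫
      ((A.cancelIso e' X').hom ⊗ₘ (A.cancelIso e' X'').hom) =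
        (A.act h').map (B.actTensorIso h X' X'').hom ≫ (A.cancelIso e' (X' ⊗ X'')).hom := by
    rw [← B.cancelIso_tensor, Iso.inv_hom_id_assoc]
  rw [Category.assoc, B.unbraiding_naturality_left e hF hX'', ← h₂]
  simp only [Category.assoc, ← MonoidalCategory.tensorHom_def, h₃]
  simp only [actCoev, Functor.map_comp, Category.assoc, Iso.inv_hom_id_assoc,
    Iso.map_inv_hom_id_assoc, A.cancelIso_naturality]
  rw [reassoc_of% B.cancelIso_unit e']

/-- The comparison between the image under the action of the dual `^{h'} X'` of `X` for the opposite
product and the dual `^{g'}(^a X')` of `^a X`. -/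
def GBraided.reverseDualAct {a h' g' m : G} (em : a * h' = m) (em' : g' * a = m) (X' : C) :
    (A.act a).obj ((A.act h').obj X') ≅ (A.act g').obj ((A.act a).obj X') :=
  A.mulIso em X' ≪≫ (A.mulIso em' X').symm

theorem GBraided.reverseDualAct_ev {a h h' g g' m : G} (e : h * h' = 1) (e' : g * g' = 1)
    (em : a * h' = m) (em' : g' * a = m) {X X' : C} (hX : P h X) (hX' : P g ((A.act a).obj X))
    (φ : X' ⊗ X ⟶ 𝟙_ C) :
    (A.act a).obj X ◁ (GBraided.reverseDualAct em em' X').hom ≫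
        (B.unbraiding e' hX' ((A.act a).obj X')).hom ≫ B.actEv a φ =
      B.actEv a ((B.unbraiding e hX X').hom ≫ φ) := by
  have h := B.unbraiding_act e e' em em' hX hX' X'
  simp only [actEv, reverseDualAct, Functor.map_comp, Category.assoc, ← reassoc_of% h]
  simp

theorem GBraided.reverseDualAct_reverseEv {a h' g' m : G} (em : a * h' = m) (em' : g' * a = m)
    {X X' : C} (hD : P h' ((A.act h').obj X')) (hD' : P g' ((A.act g').obj ((A.act a).obj X')))
    (φ : X ⊗ X' ⟶ 𝟙_ C) :
    (GBraided.reverseDualAct em em' X').hom ▷ (A.act a).obj X ≫ B.reverseEv hD' (B.actEv a φ) =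
      B.actEv a (B.reverseEv hD φ) := by
  have hFD : P g' ((A.act a).obj ((A.act h').obj X')) := B.act_mem' (em'.trans em.symm) hD
  have h := B.braiding_act' hD hFD em em' X
  have h' : (A.act g').obj ((A.act a).obj X) ◁ (reverseDualAct em em' X').hom ≫
      ((A.mulIso em' X).hom ⊗ₘ (A.mulIso em' X').hom) =
        (A.mulIso em' X).hom ▷ _ ≫ (A.act m).obj X ◁ (A.mulIso em X').hom := by
    rw [MonoidalCategory.tensorHom_def', ← whiskerLeft_comp_assoc, whisker_exchange]
    simp [reverseDualAct]
  rw [reverseEv, reassoc_of% B.braiding_naturality_left hFD hD', B.actEv_actEv em', reassoc_of% h',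
    ← reassoc_of% h, ← MonoidalCategory.tensorHom_def_assoc, ← B.actEv_actEv em]
  simp [actEv, reverseEv]

end ReversePairings

/-! ### The pivotal structure for the opposite product -/

section ReversePivotal

variable {k : Type w} {G : Type t} {C : Type u} [Field k] [Group G] [Category.{v} C] [Abelian C]
  [Linear k C] [MultitensorCategory k C] {A : GAction k G C} {P : G → ObjectProperty C}
  (B : GBraided A P)

/-- The double dual functor for the opposite product. -/
abbrev reverseDoubleDual (C : Type u) [Category.{v} C] [Preadditive C] [MonoidalCategory C]
    [RigidCategory C] : C ⥤ C :=
  @doubleDualFunctor C _ (reverseMonoidal C) (reverseRigid C).toRightRigidCategory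

variable (k C) in
theorem reverseDoubleDual_additive : (reverseDoubleDual C).Additive :=
  @doubleDualFunctor_additive C _ _ (reverseMonoidal C)
    (reverseMultitensor k C).toMonoidalPreadditive (reverseRigid C).toRightRigidCategory

/-- `pivotalEv` for the opposite product. -/
abbrev reversePivotalEv {Z X X' : C} (δ : Z ⟶ (reverseDoubleDual C).obj X)
    (p : ExactPairing X' X) : X' ⊗ Z ⟶ 𝟙_ C :=
  @pivotalEv C _ (reverseMonoidal C) (reverseRigid C).toRightRigidCategory Z X X' δ
    (reversePairing p)

/-- The pivotal structure for the opposite product on the homogeneous object `X`: that of `B`,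
followed by the identification of the double duals. -/
def GBraided.reversePivotalIso {h : G} {X : C} (hX : P h X) : X ≅ (reverseDoubleDual C).obj X :=
  B.pivotal.iso X ≪≫
    @doubleDualIso C _ (reverseMonoidal C) (reverseRigid C).toRightRigidCategory _ _ _
      (reversePairing (B.reverseDual (mul_inv_cancel h) hX
        (B.actDual_mem (mul_inv_cancel h) hX inferInstance) (inferInstance : ExactPairing X Xᘁ)))
      (reversePairing (B.reverseDualDual (mul_inv_cancel h)
        (B.dual_mem' (mul_inv_cancel h) hX (inferInstance : ExactPairing X Xᘁ))
        (B.act_mem' rfl (B.dual_mem' (inv_mul_cancel h)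
          (B.dual_mem' (mul_inv_cancel h) hX (inferInstance : ExactPairing X Xᘁ))
          (inferInstance : ExactPairing Xᘁ (Xᘁ)ᘁ)))
        (inferInstance : ExactPairing Xᘁ (Xᘁ)ᘁ)))

/-- The pairing attached to the reverse pivotal structure is the transport of the pairing attached
to that of `B`, for any dual of `X`. -/
theorem GBraided.reversePivotalEv_reversePivotalIso {h h' : G} (e : h * h' = 1) {X X' : C}
    (hX : P h X) (hD : P h' ((A.act h').obj X')) (r : ExactPairing X X') :
    reversePivotalEv (B.reversePivotalIso hX).hom (B.reverseDual e hX hD r) =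
      B.reverseEv hD (pivotalEv (B.pivotal.iso X).hom r) := by
  obtain rfl := eq_inv_of_mul_eq_one_right e
  have hD₀ := B.actDual_mem (mul_inv_cancel h) hX (inferInstance : ExactPairing X Xᘁ)
  have h₁ := @pivotalEv_comp_doubleDualIso C _ (reverseMonoidal C)
    (reverseRigid C).toRightRigidCategory
  have h₂ := @pivotalEv_congr C _ (reverseMonoidal C)
    (reverseRigid C).toRightRigidCategory X X _ _
    ((A.act h⁻¹).map (rightDualIso r (inferInstance : ExactPairing X Xᘁ)).hom)
    (B.reversePivotalIso hX).hom (reversePairing (B.reverseDual e hX hD r))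
    (reversePairing (B.reverseDual e hX hD₀ inferInstance)) ?_
  · refine h₂.trans ((congrArg (CategoryStruct.comp _) (h₁ _ _ _)).trans ?_)
    change (A.act h⁻¹).map _ ▷ X ≫ (A.act h⁻¹).obj Xᘁ ◁ (B.pivotal.iso X).hom ≫
      (B.reverseDualDual e _ _ _).evaluation _ _ = _
    rw [B.reverseDualDual_evaluation (hD := hD₀), B.whiskerLeft_reverseEv,
      B.map_whiskerRight_reverseEv hD, pivotalEv, whisker_exchange_assoc]
  · change X ◁ (A.act h⁻¹).map _ ≫ (B.unbraiding e hX Xᘁ).hom ≫ ExactPairing.evaluation X Xᘁ =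
      (B.unbraiding e hX X').hom ≫ r.evaluation X X'
    rw [reassoc_of% B.unbraiding_naturality_right, rightDualIso_ev]

theorem GBraided.reversePivotalIso_naturality {h : G} {X Y : C} (hX : P h X) (hY : P h Y)
    (f : X ⟶ Y) :
    f ≫ (B.reversePivotalIso hY).hom =
      (B.reversePivotalIso hX).hom ≫ (reverseDoubleDual C).map f := by
  have e := mul_inv_cancel h
  have hDX := B.actDual_mem e hX (inferInstance : ExactPairing X Xᘁ)
  have hDY := B.actDual_mem e hY (inferInstance : ExactPairing Y Yᘁ)
  refine @natural_of_pivotalEv C _ (reverseMonoidal C) (reverseRigid C).toRightRigidCategory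
    _ _ _ _ f ((A.act h⁻¹).map (rightAdjointMate f)) _ _
    (reversePairing (B.reverseDual e hX hDX inferInstance))
    (reversePairing (B.reverseDual e hY hDY inferInstance)) ?_ ?_
  · exact B.unbraiding_dinatural e hX hY f _ _ _ (rightAdjointMate_comp_evaluation f)
  · change _ ◁ f ≫ reversePivotalEv _ (B.reverseDual e hY hDY inferInstance) =
      (A.act h⁻¹).map _ ▷ X ≫ reversePivotalEv _ (B.reverseDual e hX hDX inferInstance)
    rw [B.reversePivotalEv_reversePivotalIso, B.reversePivotalEv_reversePivotalIso,
      B.whiskerLeft_reverseEv, B.map_whiskerRight_reverseEv hDY,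
      pivotalEv_dinatural _ _ (rightAdjointMate_comp_evaluation f) (B.pivotal.naturality f)]

end ReversePivotal

section HomogeneousExtension

variable {G : Type t} {C : Type u} [Group G] [Category.{v} C] [Abelian C] [MonoidalCategory C]
  [RightRigidCategory C] {P : G → ObjectProperty C}

/-- Compatibility of a natural morphism to the double dual with tensor products can be checked on
homogeneous objects. -/
theorem IsGGrading.tensor_doubleDual_of_homogeneous [MonoidalPreadditive C] (hP : IsGGrading P)
    (Φ : ∀ X : C, X ⟶ (Xᘁ)ᘁ)
    (hΦ : ∀ {X Y : C} (f : X ⟶ Y), f ≫ Φ Y = Φ X ≫ rightAdjointMate (rightAdjointMate f))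
    (h : ∀ {g h : G} {X Y : C}, P g X → P h Y →
      Φ (X ⊗ Y) = (Φ X ⊗ₘ Φ Y) ≫ (tensorDoubleDualIso X Y).hom) (X Y : C) :
    Φ (X ⊗ Y) = (Φ X ⊗ₘ Φ Y) ≫ (tensorDoubleDualIso X Y).hom := by
  -- Both sides are natural.
  have key {X₁ X₂ Y₁ Y₂ : C} (f : X₁ ⟶ X₂) (f' : Y₁ ⟶ Y₂)
      (h₁ : Φ (X₁ ⊗ Y₁) = (Φ X₁ ⊗ₘ Φ Y₁) ≫ (tensorDoubleDualIso X₁ Y₁).hom) :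
      (f ⊗ₘ f') ≫ Φ (X₂ ⊗ Y₂) =
        (f ⊗ₘ f') ≫ (Φ X₂ ⊗ₘ Φ Y₂) ≫ (tensorDoubleDualIso X₂ Y₂).hom := by
    rw [hΦ, h₁, tensorHom_comp_tensorHom_assoc, hΦ, hΦ, Category.assoc,
      ← tensorDoubleDualIso_naturality, tensorHom_comp_tensorHom_assoc]
  refine hP.hom_ext (tensorRight Y) fun {g X₁} hX i => ?_
  have hi : (tensorRight Y).map i = i ⊗ₘ 𝟙 Y := by simp
  rw [hi]
  refine key i (𝟙 Y) (hP.hom_ext (tensorLeft X₁) fun {g' Y₁} hY j => ?_)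
  have hj : (tensorLeft X₁).map j = 𝟙 X₁ ⊗ₘ j := by simp
  rw [hj]
  exact key (𝟙 X₁) j (h hX hY)

/-- Pivotality of a monoidal functor can be checked on homogeneous objects. -/
theorem IsGGrading.isPivotalFunctor_of_homogeneous (hP : IsGGrading P) (F : C ⥤ C) [F.Monoidal]
    [F.Additive] (δ : PivotalStructure C)
    (h : ∀ {g : G} {X : C}, P g X → (δ.iso (F.obj X)).hom = F.map (δ.iso X).hom ≫
      (mapDoubleDualIso F X).hom) :
    IsPivotalFunctor F δ δ := by
  intro X
  refine hP.hom_ext F fun {g X₁} hX i => ?_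
  rw [δ.naturality, h hX, ← Functor.map_comp_assoc, δ.naturality, Functor.map_comp_assoc,
    mapDoubleDualIso_naturality, Category.assoc]

end HomogeneousExtension

section ReversePivotal

attribute [local instance] Abelian.hasFiniteBiproducts

variable {k : Type w} {G : Type t} {C : Type u} [Field k] [Group G] [Category.{v} C] [Abelian C]
  [Linear k C] [MultitensorCategory k C] {A : GAction k G C} {P : G → ObjectProperty C}
  (B : GBraided A P)

/-- The components `C_{g⁻¹}` grade the opposite product. -/
theorem IsGGrading.reverse {C : Type u} [Category.{v} C] [Abelian C] [MonoidalCategory C]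
    {P : G → ObjectProperty C} (hP : IsGGrading P) :
    @IsGGrading G C _ _ _ (reverseMonoidal C) (fun g => P g⁻¹) :=
  @IsGGrading.mk G C _ _ _ (reverseMonoidal C) (fun g => P g⁻¹)
    (fun g => hP.iso g⁻¹) (fun g => hP.zero g⁻¹) (fun g => hP.kernels g⁻¹)
    (fun g => hP.cokernels g⁻¹) (fun g => hP.finiteProducts g⁻¹)
    (fun hgh hX hY f => hP.hom_eq_zero (fun e => hgh (inv_injective e)) hX hY f)
    (fun Y => by
      obtain ⟨S, X, hX, ⟨e⟩⟩ := hP.decomposition Y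
      let i : S.map (Equiv.inv G).toEmbedding ≃ S :=
        (Equiv.inv G).subtypeEquiv fun g => by simp
      exact ⟨S.map (Equiv.inv G).toEmbedding, X ∘ i, fun g => hX (i g),
        ⟨e ≪≫ (biproduct.whiskerEquiv i fun _ => Iso.refl _).symm⟩⟩)
    (fun {g h X Y} hX hY => by
      rw [mul_inv_rev]
      exact hP.tensor hY hX)

/-- Nested pairings for the opposite product. -/
theorem reverse_nestedPairing {C : Type u} [Category.{v} C] [MonoidalCategory C] {X X' Y Y' : C}
    (eX : X' ⊗ X ⟶ 𝟙_ C) (eY : Y' ⊗ Y ⟶ 𝟙_ C) :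
    @nestedPairing C _ (reverseMonoidal C) X X' Y Y' eX eY = nestedPairing eX eY := by
  change (α_ _ _ _).inv ≫ ((α_ _ _ _).hom ≫ X' ◁ eY ≫ (ρ_ _).hom) ▷ X ≫ eX = _
  rw [nestedPairing]
  monoidal

theorem GBraided.reversePivotalIso_tensor {g h l : G} {X Y : C} (hX : P g X) (hY : P h Y)
    (hYX : P l (Y ⊗ X)) (el : h * g = l) :
    (B.reversePivotalIso hYX).hom =
      ((B.reversePivotalIso hY).hom ⊗ₘ (B.reversePivotalIso hX).hom) ≫
        (@tensorDoubleDualIso C _ (reverseMonoidal C) (reverseRigid C).toRightRigidCategory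
          X Y).hom := by
  have eg := mul_inv_cancel g
  have eh := mul_inv_cancel h
  have el' := mul_inv_cancel l
  have em' : g⁻¹ * h⁻¹ = l⁻¹ := by rw [← el, mul_inv_rev]
  have hDX := B.actDual_mem eg hX (inferInstance : ExactPairing X Xᘁ)
  have hDY := B.actDual_mem eh hY (inferInstance : ExactPairing Y Yᘁ)
  let r : ExactPairing (Y ⊗ X) (Xᘁ ⊗ Yᘁ) := inferInstance
  have hD := B.actDual_mem el' hYX r
  let pX := B.reverseDual eg hX hDX (inferInstance : ExactPairing X Xᘁ)
  let pY := B.reverseDual eh hY hDY (inferInstance : ExactPairing Y Yᘁ)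
  have h₁ := (pivotalEv_tensor_iff (B.pivotal.iso Y).hom (B.pivotal.iso X).hom
    (B.pivotal.iso (Y ⊗ X)).hom (inferInstance : ExactPairing Y Yᘁ)
    (inferInstance : ExactPairing X Xᘁ)).1 (B.pivotal.tensor Y X)
  have h₂ := @pivotalEv_tensor_iff C _ (reverseMonoidal C) (reverseRigid C).toRightRigidCategory
    X Y _ _ (B.reversePivotalIso hX).hom (B.reversePivotalIso hY).hom
    (B.reversePivotalIso hYX).hom (reversePairing pX) (reversePairing pY)
  have h₃ := @tensor_evaluation_eq C _ (reverseMonoidal C) X _ Y _ (reversePairing pX)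
    (reversePairing pY)
  have h₄ := @pivotalEv_congr C _ (reverseMonoidal C) (reverseRigid C).toRightRigidCategory
    (Y ⊗ X) (Y ⊗ X) _ _ (B.reverseDualTensor em' hDX hDY) (B.reversePivotalIso hYX).hom
    (@ExactPairing.tensor C _ (reverseMonoidal C) X Y _ _ (reversePairing pX) (reversePairing pY))
    (reversePairing (B.reverseDual el' hYX hD r))
  refine h₂.2 (Eq.trans (h₄ ?_) ?_)
  · have h₅ := B.reverseDualTensor_ev eg eh el' el em' hX hY hYX hDX hDY
      (ExactPairing.evaluation X Xᘁ) (ExactPairing.evaluation Y Yᘁ)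
    rw [← tensor_evaluation_eq] at h₅
    exact h₅.trans ((reverse_nestedPairing _ _).symm.trans h₃.symm)
  · have h₅ := B.reverseDualTensor_reverseEv em' hDX hDY hD
      (pivotalEv (B.pivotal.iso X).hom (inferInstance : ExactPairing X Xᘁ))
      (pivotalEv (B.pivotal.iso Y).hom (inferInstance : ExactPairing Y Yᘁ))
    rw [← h₁, ← B.reversePivotalEv_reversePivotalIso el' hYX hD r,
      ← B.reversePivotalEv_reversePivotalIso eg hX hDX,
      ← B.reversePivotalEv_reversePivotalIso eh hY hDY] at h₅
    exact h₅.trans (reverse_nestedPairing _ _).symm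

end ReversePivotal

section ReversePivotal

variable {k : Type w} {G : Type t} {C : Type u} [Field k] [Group G] [Category.{v} C] [Abelian C]
  [Linear k C] [MultitensorCategory k C] {A : GAction k G C} {P : G → ObjectProperty C}
  (B : GBraided A P)

theorem GBraided.pivotalEv_act (a : G) {X X' : C} (r : ExactPairing X X') :
    pivotalEv (B.pivotal.iso ((A.act a).obj X)).hom (B.actPairing a r) =
      B.actEv a (pivotalEv (B.pivotal.iso X).hom r) := by
  let _ := B.monoidal a
  exact (pivotalEv_map_iff (A.act a) _ _ r).1 (B.isPivotal a X)

theorem GBraided.reversePivotalIso_act (a : G) {h g : G} {X : C} (hX : P h X)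
    (hFX : P g ((A.act a).obj X)) (eg : g * a = a * h) :
    letI := B.monoidal a
    (B.reversePivotalIso hFX).hom = (A.act a).map (B.reversePivotalIso hX).hom ≫
      (@mapDoubleDualIso C _ (reverseMonoidal C) (reverseRigid C).toRightRigidCategory C _
        (reverseMonoidal C) (reverseRigid C).toRightRigidCategory (A.act a)
        (reverseFunctorMonoidal (A.act a)) X).hom := by
  let _ := B.monoidal a
  have e := mul_inv_cancel h
  have e' := mul_inv_cancel g
  have em' : g⁻¹ * a = a * h⁻¹ := by
    rw [inv_mul_eq_iff_eq_mul, ← mul_assoc, eg, mul_inv_cancel_right]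
  let r : ExactPairing X Xᘁ := inferInstance
  have hD := B.actDual_mem e hX r
  have hD' := B.actDual_mem e' hFX (B.actPairing a r)
  let i := (GBraided.reverseDualAct (A := A) rfl em' Xᘁ).hom
  have h₁ := @pivotalEv_map_iff C _ (reverseMonoidal C) (reverseRigid C).toRightRigidCategory C _
    (reverseMonoidal C) (reverseRigid C).toRightRigidCategory (A.act a)
    (reverseFunctorMonoidal (A.act a)) X _ (B.reversePivotalIso hX).hom
    (B.reversePivotalIso hFX).hom (reversePairing (B.reverseDual e hX hD r))
  have h₂ := @pivotalEv_congr C _ (reverseMonoidal C) (reverseRigid C).toRightRigidCategory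
    ((A.act a).obj X) ((A.act a).obj X) _ _ i (B.reversePivotalIso hFX).hom
    (@mapExactPairing C _ (reverseMonoidal C) C _ (reverseMonoidal C) (A.act a)
      (reverseFunctorMonoidal (A.act a)) _ _ (reversePairing (B.reverseDual e hX hD r)))
    (reversePairing (B.reverseDual e' hFX hD' (B.actPairing a r)))
  refine h₁.2 (Eq.trans (h₂ ?_) ?_)
  · exact B.reverseDualAct_ev e e' rfl em' hX hFX (r.evaluation X Xᘁ)
  · have h₃ := B.reverseDualAct_reverseEv rfl em' hD hD' (pivotalEv (B.pivotal.iso X).hom r)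
    rw [← B.pivotalEv_act, ← B.reversePivotalEv_reversePivotalIso e hX hD r,
      ← B.reversePivotalEv_reversePivotalIso e' hFX hD'] at h₃
    exact h₃

theorem GBraided.exists_reversePivotal :
    ∃ δ : @PivotalStructure C _ (reverseMonoidal C) (reverseRigid C).toRightRigidCategory,
      ∀ {h : G} {X : C} (hX : P h X),
        (@PivotalStructure.iso C _ (reverseMonoidal C) (reverseRigid C).toRightRigidCategory
          δ X).hom =
          (B.reversePivotalIso hX).hom := by
  have := reverseDoubleDual_additive k C
  obtain ⟨Φ, hΦ, hΦ'⟩ := B.grading.exists_natural_extension (reverseDoubleDual C)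
    (fun hX => B.reversePivotalIso hX) (fun hX hY f => B.reversePivotalIso_naturality hX hY f)
  refine ⟨@PivotalStructure.mk C _ (reverseMonoidal C) (reverseRigid C).toRightRigidCategory
    Φ hΦ ?_, hΦ'⟩
  refine @IsGGrading.tensor_doubleDual_of_homogeneous G C _ _ _ (reverseMonoidal C)
    (reverseRigid C).toRightRigidCategory _ (reverseMultitensor k C).toMonoidalPreadditive
    B.grading.reverse (fun X => (Φ X).hom) hΦ ?_
  intro g h X Y hX hY
  have hYX := B.grading.tensor hY hX
  refine (hΦ' hYX).trans ((B.reversePivotalIso_tensor hX hY hYX rfl).trans ?_)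
  rw [← hΦ' hX, ← hΦ' hY]
  rfl

/-- The pivotal structure for the opposite product, the extension of `GBraided.reversePivotalIso`
from homogeneous objects. -/
def GBraided.reversePivotal :
    @PivotalStructure C _ (reverseMonoidal C) (reverseRigid C).toRightRigidCategory :=
  B.exists_reversePivotal.choose

theorem GBraided.reversePivotal_iso {h : G} {X : C} (hX : P h X) :
    (@PivotalStructure.iso C _ (reverseMonoidal C) (reverseRigid C).toRightRigidCategory
      B.reversePivotal X).hom = (B.reversePivotalIso hX).hom :=
  B.exists_reversePivotal.choose_spec hX

theorem GBraided.reversePivotal_act (a : G) :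
    letI := B.monoidal a
    @IsPivotalFunctor C _ (reverseMonoidal C) C _ (reverseMonoidal C)
      (reverseRigid C).toRightRigidCategory (reverseRigid C).toRightRigidCategory (A.act a)
      (reverseFunctorMonoidal (A.act a)) B.reversePivotal B.reversePivotal := by
  let _ := B.monoidal a
  have := A.additive a
  refine @IsGGrading.isPivotalFunctor_of_homogeneous G C _ _ _ (reverseMonoidal C)
    (reverseRigid C).toRightRigidCategory _ B.grading.reverse (A.act a)
    (reverseFunctorMonoidal (A.act a)) _ B.reversePivotal ?_
  intro g X hX
  have hFX := B.act_mem a hX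
  refine (B.reversePivotal_iso hFX).trans
    ((B.reversePivotalIso_act a hX hFX (inv_mul_cancel_right _ _)).trans ?_)
  rw [← B.reversePivotal_iso hX]
  rfl

end ReversePivotal

/-! ### The reverse -/

section Reverse

variable {k : Type w} {G : Type t} {C : Type u} [Field k] [Group G] [Category.{v} C] [Abelian C]
  [Linear k C] [MultitensorCategory k C] {A : GAction k G C} {P : G → ObjectProperty C}
  (B : GBraided A P)

/-- The `G`-crossed structure on the opposite product. -/
def GBraided.reverseCrossed :
    @GCrossed k G C _ _ _ _ _ (reverseMultitensor k C) A (fun g => P g⁻¹) :=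
  @GCrossed.mk k G C _ _ _ _ _ (reverseMultitensor k C) A (fun g => P g⁻¹)
    B.grading.reverse B.reversePivotal
    (fun g => letI := B.monoidal g; reverseFunctorMonoidal (A.act g))
    (fun g h => by
      let _ := B.monoidal g
      let _ := B.monoidal h
      let _ := B.monoidal (g * h)
      have := B.mul_isMonoidal g h
      exact reverse_isMonoidal (A.mul g h).hom)
    (by
      let _ := B.monoidal 1
      have := B.one_isMonoidal
      exact reverse_isMonoidal A.one.hom)
    B.reversePivotal_act
    (fun g {h X} hX => by
      have := B.act_mem g hX
      simpa [mul_assoc] using this)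

/-- The `G`-braiding of the opposite product: the inverse of the `G`-braiding, for an object
`X ∈ C_{g⁻¹}`. -/
def GBraided.reverseBraiding {g : G} {X : C} (hX : P g⁻¹ X) (Y : C) :
    Y ⊗ X ≅ X ⊗ (A.act g).obj Y :=
  (B.unbraiding (inv_mul_cancel g) hX Y).symm

/-- The `G`-braided structure on the opposite product. -/
def GBraided.reverseBraided :
    @GBraided k G C _ _ _ _ _ (reverseMultitensor k C) A (fun g => P g⁻¹) :=
  @GBraided.mk k G C _ _ _ _ _ (reverseMultitensor k C) A (fun g => P g⁻¹) B.reverseCrossed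
    (fun hX Y => B.reverseBraiding hX Y)
    (fun {g X X' Y Y'} hX hX' f f' => by
      change (f' ⊗ₘ f) ≫ (B.reverseBraiding hX' Y').hom =
        (B.reverseBraiding hX Y).hom ≫ (f ⊗ₘ (A.act g).map f')
      have h : (f ⊗ₘ (A.act g).map f') ≫ (B.unbraiding (inv_mul_cancel g) hX' Y').hom =
          (B.unbraiding (inv_mul_cancel g) hX Y).hom ≫ (f' ⊗ₘ f) := by
        rw [MonoidalCategory.tensorHom_def', Category.assoc,
          B.unbraiding_naturality_left _ hX hX', reassoc_of% B.unbraiding_naturality_right,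
          MonoidalCategory.tensorHom_def]
      rw [← cancel_epi (B.unbraiding (inv_mul_cancel g) hX Y).hom, ← reassoc_of% h]
      simp [reverseBraiding])
    (fun h {g X} hX Y => by
      have hFX : P (h * g * h⁻¹)⁻¹ ((A.act h).obj X) := B.act_mem' (by group) hX
      change (B.actTensorIso h Y X).hom ≫ (A.act h).map (B.reverseBraiding hX Y).hom ≫
        (B.actTensorIso h X ((A.act g).obj Y)).inv ≫
          (A.act h).obj X ◁ (A.mulIso rfl Y).hom =
        (B.reverseBraiding hFX ((A.act h).obj Y)).hom ≫ (A.act h).obj X ◁ (A.mulIso _ Y).hom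
      have e' : h * g * h⁻¹ * h = h * g := inv_mul_cancel_right _ _
      have h₁ := B.unbraiding_act (inv_mul_cancel g) (inv_mul_cancel (h * g * h⁻¹)) rfl e' hX hFX Y
      rw [← cancel_epi ((A.act h).obj X ◁ (A.mulIso rfl Y).hom ≫
        (A.act h).obj X ◁ (A.mulIso e' Y).inv ≫
          (B.unbraiding (inv_mul_cancel _) hFX ((A.act h).obj Y)).hom)]
      simp only [Category.assoc, reassoc_of% h₁, reverseBraiding, Iso.symm_hom]
      simp [← Functor.map_comp_assoc])
    (fun {g₁ g₂ X₁ X₂} h₁ h₂ Y => by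
      have h : P (g₁ * g₂)⁻¹ (X₂ ⊗ X₁) := by
        rw [mul_inv_rev]; exact B.grading.tensor h₂ h₁
      change (B.reverseBraiding h Y).hom =
        (α_ Y X₂ X₁).inv ≫ (B.reverseBraiding h₂ Y).hom ▷ X₁ ≫
          (α_ X₂ ((A.act g₂).obj Y) X₁).hom ≫
            X₂ ◁ (B.reverseBraiding h₁ ((A.act g₂).obj Y)).hom ≫
              X₂ ◁ X₁ ◁ (A.mulIso rfl Y).hom ≫ (α_ X₂ X₁ ((A.act (g₁ * g₂)).obj Y)).inv
      have h₃ := B.unbraiding_tensor_left (inv_mul_cancel g₂) (inv_mul_cancel g₁)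
        (inv_mul_cancel (g₁ * g₂)) (mul_inv_rev g₁ g₂).symm rfl h₂ h₁ h Y
      rw [← cancel_epi ((X₂ ⊗ X₁) ◁ (A.mulIso rfl Y).hom ≫
        (B.unbraiding (inv_mul_cancel (g₁ * g₂)) h Y).hom)]
      conv_rhs => rw [h₃]
      simp [reverseBraiding])
    (fun {g X} hX Y₁ Y₂ => by
      change (B.reverseBraiding hX (Y₂ ⊗ Y₁)).hom = (α_ Y₂ Y₁ X).hom ≫
        Y₂ ◁ (B.reverseBraiding hX Y₁).hom ≫ (α_ Y₂ X ((A.act g).obj Y₁)).inv ≫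
          (B.reverseBraiding hX Y₂).hom ▷ (A.act g).obj Y₁ ≫
            (α_ X ((A.act g).obj Y₂) ((A.act g).obj Y₁)).hom ≫
              X ◁ (B.actTensorIso g Y₂ Y₁).hom
      have h := B.unbraiding_tensor_right (inv_mul_cancel g) hX Y₂ Y₁
      rw [← cancel_epi (X ◁ (B.actTensorIso g Y₂ Y₁).hom ≫
        (B.unbraiding (inv_mul_cancel g) hX (Y₂ ⊗ Y₁)).hom)]
      conv_rhs => rw [h]
      simp [reverseBraiding])

/-- The reverse of a `G`-braided multitensor category: the opposite product, with the inverse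
`G`-braiding. -/
def GBraided.reverse : GBraidedMultitensor A (fun g => P g⁻¹) :=
  ⟨reverseMultitensor k C, B.reverseBraided⟩

/-- The opposite product of `X` and `Y ∈ C_h` is identified with `^h X ⊗ Y` by the `G`-braiding of
`Y` with `X`. -/
def GBraided.reverseData : ReverseData B B.reverse where
  unit_eq := rfl
  unit_mem := B.grading.unit_mem
  tensorIso X _ _ hY := B.braiding hY X
  tensorIso_naturality hY hY' f f' := B.braiding_naturality hY hY' f' f
  associator_eq X {g h Y Z} hY hZ := by
    have hZY : P (h * g) (Z ⊗ Y) := B.mem_of_iso (B.braiding hZ Y) hY hZ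
    change (α_ Z Y X).inv ≫ (B.braiding hZY X).hom ≫
        (A.act (h * g)).obj X ◁ (B.braiding hZ Y).hom =
      (B.braiding hZ (Y ⊗ X)).hom ≫ (A.act h).map (B.braiding hY X).hom ▷ Z ≫
        (B.actTensorIso h ((A.act g).obj X) Y).inv ▷ Z ≫ (α_ _ _ Z).hom ≫
          (A.mulIso rfl X).hom ▷ ((A.act h).obj Y ⊗ Z)
    rw [B.braiding_tensor_left' rfl hZ hY, ← reassoc_of% B.braiding_naturality_right,
      B.braiding_tensor_right']
    simp only [Category.assoc, Iso.inv_hom_id_assoc, hom_inv_whiskerRight_assoc]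
    rw [associator_naturality_left_assoc, ← whisker_exchange]
  leftUnitor_eq {h X} hX := by
    change (ρ_ X).hom = (B.braiding hX (𝟙_ C)).hom ≫ (A.act h).map (𝟙 (𝟙_ C)) ▷ X ≫
      (B.actUnitIso h).inv ▷ X ≫ (λ_ X).hom
    rw [B.braiding_unit_right]
    simp
  rightUnitor_eq X := by
    change (λ_ X).hom = (B.braiding B.grading.unit_mem X).hom ≫
      ((A.oneIso X).hom ⊗ₘ 𝟙 (𝟙_ C)) ≫ (ρ_ X).hom
    rw [B.braiding_unit_left]
    simp
  actTensor_eq g X {h Y} hY := B.braiding_act g hY X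
  actUnit_eq g := by
    change (B.actUnitIso g).hom ≫ (A.act g).map (𝟙 (𝟙_ C)) = 𝟙 (𝟙_ C) ≫ (B.actUnitIso g).hom
    simp
  braiding_eq {g h X Y} hX hY := by
    change (B.unbraiding (inv_mul_cancel g) hX Y).inv ≫
      (B.unbraiding (inv_mul_cancel g) hX Y).hom =
        (B.braiding hY X).hom ≫ (B.braiding hY X).inv
    simp
  pivotal_eq {h X} hX := by
    have e := mul_inv_cancel h
    have hX' := B.dual_mem' e hX (inferInstance : ExactPairing X Xᘁ)
    have hD := B.actDual_mem e hX (inferInstance : ExactPairing X Xᘁ)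
    have hDD := B.dual_mem' (inv_mul_cancel h) hX' (inferInstance : ExactPairing Xᘁ (Xᘁ)ᘁ)
    have hE : P h ((A.act h).obj (Xᘁ)ᘁ) := B.act_mem' rfl hDD
    refine ⟨hD, hDD, reversePairing (B.reverseDual e hX hD inferInstance),
      reversePairing (B.reverseDualDual e hX' hE inferInstance), ?_, ?_, ?_, ?_, ?_⟩
    · change (B.unbraiding e hX Xᘁ).hom ≫ ExactPairing.evaluation X Xᘁ =
        (B.braiding hX _).hom ≫ (A.cancelIso e Xᘁ).hom ▷ X ≫
          ExactPairing.evaluation X Xᘁ ≫ 𝟙 (𝟙_ C)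
      simp [unbraiding_hom]
    · change (B.actCoev h⁻¹ (ExactPairing.coevaluation X Xᘁ) ≫ (B.braiding hD X).inv) ≫
        (B.braiding hD X).hom = 𝟙 (𝟙_ C) ≫ B.actCoev h⁻¹ (ExactPairing.coevaluation X Xᘁ)
      simp
    · refine (B.reverseDualDual_evaluation e hX' hD hE inferInstance).trans ?_
      change B.reverseEv hD (ExactPairing.evaluation Xᘁ (Xᘁ)ᘁ) = (B.braiding hD (Xᘁ)ᘁ).hom ≫
        (B.actTensorIso h⁻¹ (Xᘁ)ᘁ Xᘁ).hom ≫ (A.act h⁻¹).map (ExactPairing.evaluation Xᘁ (Xᘁ)ᘁ) ≫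
          (B.actUnitIso h⁻¹).inv ≫ 𝟙 (𝟙_ C)
      simp [reverseEv, actEv]
    · exact (B.reverseDualDual_coevaluation e hX' hDD hE inferInstance).trans
        (Category.id_comp _).symm
    · exact B.reversePivotal_iso hX

end Reverse

end GBraidedReverse

end

theorem mainTheorem10 {k : Type w} {G : Type t} {C : Type u} [Field k] [Group G] [Category.{v} C]
    [Abelian C] [Linear k C] [GBraidedReverse.MultitensorCategory k C]
    (A : GBraidedReverse.GAction k G C) (P : G → ObjectProperty C)
    (B : GBraidedReverse.GBraided A P) :
    ∃ R : GBraidedReverse.GBraidedMultitensor A (fun g => P g⁻¹),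
      Nonempty (GBraidedReverse.ReverseData B R) :=
  ⟨B.reverse, ⟨B.reverseData⟩⟩
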